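/- **Conventions.** For $p\in\mathbb Z[x]$ of degree $d$, call $p$ *$\gamma$-positive* if $p=\sum_{0\le i\le d/2}\gamma_i\,x^i(1+x)^{d-2i}$ with all $\gamma_i$ nonnegative integers, *nonnegative* if all its coefficients are nonnegative, *palindromic* if the coefficients of $x^i$ and $x^{d-i}$ agree for all $0\le i\le d$, and *unimodal* if its coefficient sequence weakly increases up to some index and weakly decreases afterwards. A *finite graded poset* is a finite poset $P$ with minimum $\hat 0$ and maximum $\hat 1$ such that, for every $F\in P$, all maximal chains from $\hat 0$ to $F$ have the same length $\mathrm{rank}(F)$; its rank is $n=\mathrm{rank}(\hat 1)$. An *R-labeling* of $P$ is a labeling $\lambda$ of the cover relations of $P$ by nonnegative integers such that every interval of $P$ contains exactly one maximal chain along which $\lambda$ is weakly increasing. Let $\mu$ be the Möbius function of $P$, and for $a<b$ in $P$ put $$\overline\chi_{[a,b]}(x)=\frac{1}{x-1}\sum_{a\le F\le b}\mu(a,F)\,x^{\mathrm{rank}(b)-\mathrm{rank}(F)}\in\mathbb Z[x].$$ For a chain $\mathcal C=\{\mathcal C_1<\dots<\mathcal C_{k+1}\}$ put $\overline\chi_{P,\mathcal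 C}=\prod_{i=1}^k\overline\chi_{[\mathcal C_i,\mathcal C_{i+1}]}$. The *Chow polynomial* and the *augmented Chow polynomial* of $P$ are $$\underline{\mathsf H}_P(x)=\sum_{\mathcal C:\ \mathcal C_1=\hat 0,\ \mathcal C_{k+1}=\hat 1}\overline\chi_{P,\mathcal C}(x),\qquad \mathsf H_P(x)=\sum_{\mathcal C:\ \mathcal C_{k+1}=\hat 1}x^{\mathrm{rank}(\mathcal C_1)}\,\overline\chi_{P,\mathcal C}(x)$$ (both equal to $1$ if $n=0$). Let $M$ be a loopless matroid of rank $n$ on a finite ground set $E$, with lattice of flats $\mathcal L(M)$. Its *Chow ring* is the quotient of $\mathbb Q[x_F : \emptyset\ne F\in\mathcal L(M)]$ by the ideal generated by $x_Fx_G$ for incomparable $F,G$ and by $\sum_{F\ni i}x_F$ for $i\in E$. Its *augmented Chow ring* is the quotient of $\mathbb Q[x_F, y_i : F\in\mathcal L(M)\setminus\{E\},\ i\in E]$ by the ideal generated by $x_Fx_G$ for incomparable $F,G$, by $y_ix_F$ for $i\notin F$, and by $y_i-\sum_{F\not\ni i}x_F$ for $i\in E$. All variables have degree $1$. The *Chow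 polynomial* and the *augmented Chow polynomial* of $M$ are the Hilbert–Poincaré series of these graded rings. **Theorem.** 1. Let $M$ be a loopless matroid of rank $n$ on a finite ground set. The Chow polynomial and the augmented Chow polynomial of $M$ are polynomials of degree $\max(n-1,0)$ and $n$, respectively, and both are $\gamma$-positive; in particular they are nonnegative, palindromic and unimodal. The same holds for the polynomials $\underline{\mathsf H}_{\mathcal L(M)}$ and $\mathsf H_{\mathcal L(M)}$ defined through chains in the lattice of flats. 2. Let $P$ be a finite graded poset of rank $n$ that admits an R-labeling. Then $\underline{\mathsf H}_P$ and $\mathsf H_P$ have degree $\max(n-1,0)$ and $n$, respectively, and both are $\gamma$-positive; in particular they are nonnegative, palindromic and unimodal. -/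

import Mathlib

open Polynomial

namespace ChowPolynomials

/-! ### Finite graded posets and R-labelings -/

section Poset

variable {P : Type*} [PartialOrder P]

/-- The rank of an element: the largest length of a chain ending in it. -/
noncomputable def rank (a : P) : ℕ := (Order.height a).toNat

/-- `l` lists, from bottom to top, a maximal chain `a = F₀ ⋖ F₁ ⋖ ⋯ ⋖ Fₖ = b`
of the interval `[a, b]`. -/
def IsMaximalChain (a b : P) (l : List P) : Prop :=
  l.IsChain (· ⋖ ·) ∧ l.head? = some a ∧ l.getLast? = some b

/-- A finite poset with minimum and maximum is graded if, for every `a`, all maximal chains from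
the minimum to `a` have length `rank a` (that is, `rank a + 1` elements). -/
def IsGradedPoset (P : Type*) [PartialOrder P] [BoundedOrder P] : Prop :=
  ∀ (a : P) (l : List P), IsMaximalChain ⊥ a l → l.length = rank a + 1

/-- The sequence of edge labels along the chain `l`. -/
def labels (lab : P → P → ℕ) (l : List P) : List ℕ := List.zipWith lab l l.tail

/-- An edge labeling (only the values `lab a b` with `a ⋖ b` matter) is an R-labeling if every
interval has exactly one maximal chain with weakly increasing labels. -/
def IsRLabeling (lab : P → P → ℕ) : Prop :=
  ∀ a b : P, a ≤ b → ∃! l : List P, IsMaximalChain a b l ∧ (labels lab l).IsChain (· ≤ ·)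

end Poset

/-! ### Chow and augmented Chow polynomials of finite graded posets -/

section ChainPolynomials

open scoped Classical in
/-- The Möbius function of a finite poset, with integer values. -/
noncomputable def mobius {P : Type*} [PartialOrder P] [Fintype P] (a b : P) : ℤ :=
  letI : LocallyFiniteOrder P := Fintype.toLocallyFiniteOrder
  IncidenceAlgebra.mu ℤ a b

variable {P : Type*} [PartialOrder P] [Fintype P]

open scoped Classical in
/-- The characteristic polynomial `χ_{[a,b]}` of the interval `[a, b]`. -/
noncomputable def charPoly (a b : P) : ℤ[X] :=
  ∑ F : P with a ≤ F ∧ F ≤ b, C (mobius a F) * X ^ (rank b - rank F)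

/-- The reduced characteristic polynomial `χ_{[a,b]} / (X - 1)` (the division is exact for
`a < b`). -/
noncomputable def redCharPoly (a b : P) : ℤ[X] := charPoly a b /ₘ (X - C 1)

open scoped Classical in
/-- The product of the reduced characteristic polynomials `χ̄_{[a,b]}` over all pairs of
consecutive elements `a < b` of the chain `s`. -/
noncomputable def chainRedCharPoly (s : Finset P) : ℤ[X] :=
  ∏ p ∈ s ×ˢ s with p.1 < p.2 ∧ ∀ z ∈ s, ¬ (p.1 < z ∧ z < p.2), redCharPoly p.1 p.2

open scoped Classical in
/-- The finite set of all chains of `P` with smallest element `a` and largest element `b`. -/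
noncomputable def chainsFromTo (a b : P) : Finset (Finset P) :=
  {s : Finset P | IsChain (· ≤ ·) (s : Set P) ∧ a ∈ s ∧ b ∈ s ∧ ∀ z ∈ s, a ≤ z ∧ z ≤ b}

/-- The Chow polynomial `∑_C χ̄_{P,C}(X)`, over all chains `C` from `⊥` to `⊤`. If `P` has rank `0`
there is exactly one such chain and the polynomial is `1`. -/
noncomputable def chowPoly (P : Type*) [PartialOrder P] [BoundedOrder P] [Fintype P] : ℤ[X] :=
  ∑ s ∈ chainsFromTo (⊥ : P) ⊤, chainRedCharPoly s

/-- The augmented Chow polynomial `∑_C X ^ rank(C₁) χ̄_{P,C}(X)`, over all chains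
`C = {C₁ < ⋯}` ending in `⊤`; the chains are sorted by their smallest element `C₁ = a`. -/
noncomputable def augChowPoly (P : Type*) [PartialOrder P] [BoundedOrder P] [Fintype P] : ℤ[X] :=
  ∑ a : P, ∑ s ∈ chainsFromTo a ⊤, X ^ rank a * chainRedCharPoly s

end ChainPolynomials

/-! ### The lattice of flats of a matroid -/

section Matroid

variable {α : Type*} (M : Matroid α)

/-- The flats of `M`, ordered by inclusion. -/
abbrev Flats : Type _ := {F : Set α // M.IsFlat F}

instance : BoundedOrder (Flats M) where
  top := ⟨M.E, M.ground_isFlat⟩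
  le_top F := F.2.subset_ground
  bot := ⟨M.closure ∅, M.isFlat_closure ∅⟩
  bot_le F := by
    have h := M.closure_subset_closure (Set.empty_subset F.1)
    rw [F.2.closure] at h
    exact h

instance [M.Finite] : Finite (Flats M) :=
  (M.ground_finite.finite_subsets.subset
    (fun _ hF => Matroid.IsFlat.subset_ground hF : {F | M.IsFlat F} ⊆ {F | F ⊆ M.E})).to_subtype

noncomputable instance [M.Finite] : Fintype (Flats M) := Fintype.ofFinite _

/-! ### Chow ring and augmented Chow ring of a matroid -/

open scoped Classical in
/-- The ideal of relations of the Chow ring, in the polynomial ring `ℚ[x_F]` over the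
nonempty flats `F`. -/
noncomputable def chowIdeal [M.Finite] :
    Ideal (MvPolynomial {F : Flats M // F.1.Nonempty} ℚ) :=
  Ideal.span
    ({f | ∃ F G : {F : Flats M // F.1.Nonempty}, ¬ F ≤ G ∧ ¬ G ≤ F ∧
        f = MvPolynomial.X F * MvPolynomial.X G} ∪
     {f | ∃ i ∈ M.E, f = ∑ F : {F : Flats M // F.1.Nonempty} with i ∈ F.1.1, MvPolynomial.X F})

open scoped Classical in
/-- The ideal of relations of the augmented Chow ring, in the polynomial ring `ℚ[x_F, y_i]` over
the proper flats `F` (`x_F` is the variable `Sum.inl F`) and the elements `i` of the ground set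
(`y_i` is the variable `Sum.inr i`). -/
noncomputable def augChowIdeal [M.Finite] :
    Ideal (MvPolynomial ({F : Flats M // F ≠ ⊤} ⊕ M.E) ℚ) :=
  Ideal.span
    ({f | ∃ F G : {F : Flats M // F ≠ ⊤}, ¬ F ≤ G ∧ ¬ G ≤ F ∧
        f = MvPolynomial.X (Sum.inl F) * MvPolynomial.X (Sum.inl G)} ∪
     {f | ∃ (i : M.E) (F : {F : Flats M // F ≠ ⊤}), i.1 ∉ F.1.1 ∧
        f = MvPolynomial.X (Sum.inr i) * MvPolynomial.X (Sum.inl F)} ∪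
     {f | ∃ i : M.E, f = MvPolynomial.X (Sum.inr i) -
        ∑ F : {F : Flats M // F ≠ ⊤} with i.1 ∉ F.1.1, MvPolynomial.X (Sum.inl F)})

/-- The degree `d` part of `ℚ[x_s : s ∈ σ] / I`, for a homogeneous ideal `I` and all variables in
degree one: the image of the homogeneous polynomials of degree `d`. -/
noncomputable def quotientPiece {σ : Type*} (I : Ideal (MvPolynomial σ ℚ)) (d : ℕ) :
    Submodule ℚ (MvPolynomial σ ℚ ⧸ I) :=
  (MvPolynomial.homogeneousSubmodule σ ℚ d).map (Ideal.Quotient.mkₐ ℚ I).toLinearMap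

/-- The Hilbert–Poincaré series of the graded ring `ℚ[x_s : s ∈ σ] / I`, for a finite set `σ`. -/
noncomputable def hilbertSeries {σ : Type*} (I : Ideal (MvPolynomial σ ℚ)) : PowerSeries ℤ :=
  PowerSeries.mk fun d => (Module.finrank ℚ (quotientPiece I d) : ℤ)

end Matroid

/-! ### γ-positivity, palindromicity, unimodality -/

/-- With `d` the degree of `p`: `p = ∑_{i ≤ d/2} γ_i X^i (1+X)^(d-2i)` with all `γ_i ≥ 0`. -/
def IsGammaPositive (p : ℤ[X]) : Prop :=
  ∃ γ : ℕ → ℤ, (∀ i, 0 ≤ γ i) ∧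
    p = ∑ i ∈ Finset.range (p.natDegree / 2 + 1),
      C (γ i) * X ^ i * (X + 1) ^ (p.natDegree - 2 * i)

/-- All coefficients are nonnegative. -/
def IsNonneg (p : ℤ[X]) : Prop := ∀ i, 0 ≤ p.coeff i

/-- With `d` the degree of `p`, the coefficients of `X^i` and `X^(d-i)` agree. -/
def IsPalindromic (p : ℤ[X]) : Prop :=
  ∀ i ≤ p.natDegree, p.coeff i = p.coeff (p.natDegree - i)

/-- The coefficients weakly increase up to some index and weakly decrease from there on. -/
def IsUnimodal (p : ℤ[X]) : Prop :=
  ∃ k, (∀ i j, i ≤ j → j ≤ k → p.coeff i ≤ p.coeff j) ∧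
    (∀ i j, k ≤ i → i ≤ j → p.coeff j ≤ p.coeff i)

/-- `p` has degree `d` and is γ-positive, nonnegative, palindromic and unimodal. -/
structure IsGoodOfDegree (d : ℕ) (p : ℤ[X]) : Prop where
  natDegree_eq : p.natDegree = d
  gammaPositive : IsGammaPositive p
  nonneg : IsNonneg p
  palindromic : IsPalindromic p
  unimodal : IsUnimodal p

end ChowPolynomials

namespace ChowPolynomials

/-! ### The cone of γ-positive polynomials -/

/-! Everything rests on one recursion. Write H_a for `upperChowPoly a`, the Chow polynomial of [a,
⊤]. Möbius inversion turns the sum over chains into H_a = 1 + ∑_{b > a} (X + ⋯ + X^(rk b − rk a −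
1)) H_b (`upperChowPoly_eq_one_add_sum`), and the augmented polynomial into 1 + ∑_b (X + ⋯ + X^(rk
b)) H_b (`augChowPoly_eq_one_add_sum`).

γ-positivity: given an R-labeling, sum `wordWeight` over the label words of all maximal chains from
a to ⊤. Every b ≥ a is reached from a by exactly one increasing chain, so the right side of the
recursion is a sum over maximal chains with a marked increasing initial segment. For a fixed word
the sum over the marked segments collapses to a single weight (`prefixSum_eq`). Hence the weighted
sum obeys the recursion of H_a (`upperChowPoly_eq_labelSum`); in the augmented case a letter 0 is
prepended (`augChowPoly_eq_labelSum`). Each weight lies in the γ-cone, and the constant term 1 pins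
down the degree. The lattice of flats has an R-labeling by the smallest new element
(`isRLabeling_minLabel`).

Chow rings: put h_G = ∑_{H ≥ G} x_H. Both rings are isomorphic to rings with relations x_F x_G = 0,
x_F h_G^m = 0 and h_G^m = 0, the exponents bounded below by rank differences (`chainIdeal`). If A_U
is the ring of an upper set U and a minimal Z is adjoined, the new ring is A_U ⊕ ⨁_{0 < i < r} x_Z^i
A_{>Z} with r = rk Z − c (`hilbertSeries_insert`). Removing minimal elements one by one shows that
the Hilbert series satisfy the same recursion as the Chow polynomials. -/

/-- The polynomials `∑ γ_i X^i (1+X)^(d-2i)` with nonnegative integers `γ_i`. -/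
noncomputable def gammaCone (d : ℕ) : AddSubmonoid ℤ[X] :=
  AddSubmonoid.closure {p | ∃ i, 2 * i ≤ d ∧ p = X ^ i * (X + 1) ^ (d - 2 * i)}

lemma one_mem_gammaCone : (1 : ℤ[X]) ∈ gammaCone 0 :=
  AddSubmonoid.subset_closure ⟨0, by simp⟩

lemma X_add_one_mul_mem_gammaCone {d : ℕ} {p : ℤ[X]} (hp : p ∈ gammaCone d) :
    (X + 1) * p ∈ gammaCone (d + 1) := by
  induction hp using AddSubmonoid.closure_induction with
  | mem p h =>
    obtain ⟨i, hi, rfl⟩ := h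
    refine AddSubmonoid.subset_closure ⟨i, by omega, ?_⟩
    rw [show d + 1 - 2 * i = d - 2 * i + 1 by omega]
    ring
  | zero => simp
  | add p q _ _ hp hq => simpa only [mul_add] using add_mem hp hq

lemma X_mul_mem_gammaCone {d : ℕ} {p : ℤ[X]} (hp : p ∈ gammaCone d) :
    X * p ∈ gammaCone (d + 2) := by
  induction hp using AddSubmonoid.closure_induction with
  | mem p h =>
    obtain ⟨i, hi, rfl⟩ := h
    refine AddSubmonoid.subset_closure ⟨i + 1, by omega, ?_⟩
    rw [show d + 2 - 2 * (i + 1) = d - 2 * i by omega]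
    ring
  | zero => simp
  | add p q _ _ hp hq => simpa only [mul_add] using add_mem hp hq

lemma exists_gamma_of_mem_gammaCone {d : ℕ} {p : ℤ[X]} (hp : p ∈ gammaCone d) :
    ∃ γ : ℕ → ℤ, (∀ i, 0 ≤ γ i) ∧
      p = ∑ i ∈ Finset.range (d / 2 + 1), C (γ i) * X ^ i * (X + 1) ^ (d - 2 * i) := by
  induction hp using AddSubmonoid.closure_induction with
  | mem p h =>
    obtain ⟨i, hi, rfl⟩ := h
    refine ⟨fun j => if j = i then 1 else 0, fun j => by positivity, ?_⟩
    rw [Finset.sum_eq_single_of_mem i (Finset.mem_range.2 (by omega))]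
    · simp
    · intro j _ hj
      simp [hj]
  | zero => exact ⟨0, by simp, by simp⟩
  | add p q _ _ hp hq =>
    obtain ⟨γ, h0, h⟩ := hp
    obtain ⟨γ', h0', h'⟩ := hq
    refine ⟨γ + γ', fun i => add_nonneg (h0 i) (h0' i), ?_⟩
    rw [h, h', ← Finset.sum_add_distrib]
    refine Finset.sum_congr rfl fun i _ => ?_
    simp only [Pi.add_apply, C_add]
    ring

lemma coeff_gammaCone_generator {d i : ℕ} (k : ℕ) :
    (X ^ i * (X + 1) ^ (d - 2 * i) : ℤ[X]).coeff k =
      if i ≤ k then ((d - 2 * i).choose (k - i) : ℤ) else 0 := by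
  rw [coeff_X_pow_mul', coeff_X_add_one_pow]

lemma coeff_nonneg_of_mem_gammaCone {d : ℕ} {p : ℤ[X]} (hp : p ∈ gammaCone d) (k : ℕ) :
    0 ≤ p.coeff k := by
  induction hp using AddSubmonoid.closure_induction with
  | mem p h =>
    obtain ⟨i, hi, rfl⟩ := h
    rw [coeff_gammaCone_generator]
    positivity
  | zero => simp
  | add p q _ _ hp hq => simpa using add_nonneg hp hq

lemma coeff_eq_zero_of_mem_gammaCone {d : ℕ} {p : ℤ[X]} (hp : p ∈ gammaCone d) {k : ℕ}
    (hk : d < k) : p.coeff k = 0 := by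
  induction hp using AddSubmonoid.closure_induction with
  | mem p h =>
    obtain ⟨i, hi, rfl⟩ := h
    rw [coeff_gammaCone_generator, if_pos (by omega), Nat.choose_eq_zero_of_lt (by omega)]
    rfl
  | zero => simp
  | add p q _ _ hp hq => simp [hp, hq]

lemma coeff_symm_of_mem_gammaCone {d : ℕ} {p : ℤ[X]} (hp : p ∈ gammaCone d) {k : ℕ}
    (hk : k ≤ d) : p.coeff k = p.coeff (d - k) := by
  induction hp using AddSubmonoid.closure_induction with
  | mem p h =>
    obtain ⟨i, hi, rfl⟩ := h
    rw [coeff_gammaCone_generator, coeff_gammaCone_generator]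
    by_cases h1 : i ≤ k
    · by_cases h2 : i ≤ d - k
      · rw [if_pos h1, if_pos h2, Nat.choose_symm_of_eq_add]
        omega
      · rw [if_pos h1, if_neg h2, Nat.choose_eq_zero_of_lt (by omega)]
        rfl
    · rw [if_neg h1, if_pos (by omega), Nat.choose_eq_zero_of_lt (by omega)]
      rfl
  | zero => simp
  | add p q _ _ hp hq => simp [hp, hq]

lemma coeff_le_coeff_succ_of_mem_gammaCone {d : ℕ} {p : ℤ[X]} (hp : p ∈ gammaCone d) {k : ℕ}
    (hk : k < d / 2) : p.coeff k ≤ p.coeff (k + 1) := by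
  induction hp using AddSubmonoid.closure_induction with
  | mem p h =>
    obtain ⟨i, hi, rfl⟩ := h
    rw [coeff_gammaCone_generator, coeff_gammaCone_generator]
    by_cases h1 : i ≤ k
    · rw [if_pos h1, if_pos (by omega), show k + 1 - i = k - i + 1 by omega]
      exact_mod_cast Nat.choose_le_succ_of_lt_half_left (by omega)
    · rw [if_neg h1]
      positivity
  | zero => simp
  | add p q _ _ hp hq => simpa using add_le_add hp hq

lemma coeff_mono_of_mem_gammaCone {d : ℕ} {p : ℤ[X]} (hp : p ∈ gammaCone d) {i j : ℕ}
    (hij : i ≤ j) (hj : j ≤ d / 2) : p.coeff i ≤ p.coeff j := by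
  induction j, hij using Nat.le_induction with
  | base => exact le_rfl
  | succ j _ ih =>
    exact (ih (by omega)).trans (coeff_le_coeff_succ_of_mem_gammaCone hp (by omega))

/-- By symmetry the coefficient of X^d equals the constant term 1, which forces the degree to be
exactly d. The decrease after d/2 is the mirror image of the increase before it. -/
lemma isGoodOfDegree_of_mem_gammaCone {d : ℕ} {p : ℤ[X]} (hp : p ∈ gammaCone d)
    (h0 : p.coeff 0 = 1) : IsGoodOfDegree d p := by
  have hd : p.natDegree = d := by
    refine natDegree_eq_of_le_of_coeff_ne_zero
      (natDegree_le_iff_coeff_eq_zero.2 fun k hk => coeff_eq_zero_of_mem_gammaCone hp hk) ?_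
    rw [coeff_symm_of_mem_gammaCone hp le_rfl, Nat.sub_self, h0]
    exact one_ne_zero
  refine ⟨hd, ?_, coeff_nonneg_of_mem_gammaCone hp, ?_, d / 2, ?_, ?_⟩
  · rw [IsGammaPositive, hd]
    exact exists_gamma_of_mem_gammaCone hp
  · intro i hi
    rw [hd] at hi ⊢
    exact coeff_symm_of_mem_gammaCone hp hi
  · exact fun i j => coeff_mono_of_mem_gammaCone hp
  · intro i j hi hij
    rcases hij.eq_or_lt with rfl | hij
    · exact le_rfl
    rcases lt_or_ge d j with hj | hj
    · rw [coeff_eq_zero_of_mem_gammaCone hp hj]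
      exact coeff_nonneg_of_mem_gammaCone hp i
    rw [coeff_symm_of_mem_gammaCone hp hj]
    rcases hi.eq_or_lt with rfl | hi
    · exact coeff_mono_of_mem_gammaCone hp (by omega) le_rfl
    · rw [coeff_symm_of_mem_gammaCone hp (hij.le.trans hj)]
      exact coeff_mono_of_mem_gammaCone hp (by omega) (by omega)

/-! ### Rank function and maximal chains -/

section Rank

variable {P : Type*} [PartialOrder P]

lemma isMaximalChain_singleton (a : P) : IsMaximalChain a a [a] := by
  simp [IsMaximalChain]

lemma IsMaximalChain.cons {a a' b : P} {l : List P} (h : a ⋖ a') (hl : IsMaximalChain a' b l) :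
    IsMaximalChain a b (a :: l) := by
  obtain ⟨h1, h2, h3⟩ := hl
  cases l with
  | nil => simp at h2
  | cons c l =>
    simp only [List.head?_cons, Option.some.injEq] at h2
    subst h2
    exact ⟨List.IsChain.cons_cons h h1, rfl, by simpa [List.getLast?_cons_cons] using h3⟩

lemma IsMaximalChain.eq_singleton_or_exists_cons {a b : P} {l : List P}
    (hl : IsMaximalChain a b l) :
    (l = [a] ∧ a = b) ∨ ∃ a' l', l = a :: a' :: l' ∧ a ⋖ a' ∧ IsMaximalChain a' b (a' :: l') := by
  obtain ⟨h1, h2, h3⟩ := hl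
  match l, h1, h2, h3 with
  | [c], h1, h2, h3 =>
    simp_all
  | c :: d :: l, h1, h2, h3 =>
    simp only [List.head?_cons, Option.some.injEq] at h2
    subst h2
    rw [List.isChain_cons_cons] at h1
    exact Or.inr ⟨d, l, rfl, h1.1, h1.2, rfl, by simpa [List.getLast?_cons_cons] using h3⟩

lemma IsMaximalChain.le {a b : P} {l : List P} (hl : IsMaximalChain a b l) : a ≤ b := by
  induction l generalizing a with
  | nil => simp [IsMaximalChain] at hl
  | cons c l ih =>
    rcases hl.eq_singleton_or_exists_cons with ⟨_, h⟩ | ⟨a', l', h, hc, h'⟩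
    · exact h.le
    · obtain ⟨rfl, rfl⟩ := List.cons.inj h
      exact hc.le.trans (ih h')

lemma exists_isMaximalChain [Finite P] {a b : P} (h : a ≤ b) : ∃ l, IsMaximalChain a b l := by
  induction a using WellFoundedGT.induction with
  | ind a ih =>
    rcases h.eq_or_lt with rfl | hlt
    · exact ⟨_, isMaximalChain_singleton a⟩
    · obtain ⟨c, hac, hcb⟩ := exists_covBy_le_of_lt hlt
      obtain ⟨l, hl⟩ := ih c hac.lt hcb
      exact ⟨_, hl.cons hac⟩

lemma height_ne_top [Finite P] (a : P) : Order.height a ≠ ⊤ := by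
  cases nonempty_fintype P
  refine ne_top_of_le_ne_top (ENat.natCast_ne_top (Fintype.card P)) (Order.height_le fun p _ => ?_)
  exact_mod_cast p.length_lt_card.le

lemma rank_strictMono [Finite P] : StrictMono (rank : P → ℕ) := by
  intro a b h
  have := Order.height_strictMono h (lt_top_iff_ne_top.2 (height_ne_top a))
  rwa [rank, rank, ← ENat.natCast_lt_natCast, ENat.natCast_toNat (height_ne_top a),
    ENat.natCast_toNat (height_ne_top b)]

lemma rank_bot [OrderBot P] : rank (⊥ : P) = 0 := by simp [rank]

lemma IsMaximalChain.append_covBy {a b c : P} {l : List P} (hl : IsMaximalChain a b l)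
    (h : b ⋖ c) : IsMaximalChain a c (l ++ [c]) := by
  induction l generalizing a with
  | nil => simp [IsMaximalChain] at hl
  | cons d l ih =>
    rcases hl.eq_singleton_or_exists_cons with ⟨h1, rfl⟩ | ⟨a', l', h1, hc, h'⟩
    · obtain ⟨rfl, rfl⟩ := List.cons.inj h1
      exact (isMaximalChain_singleton c).cons h
    · obtain ⟨rfl, rfl⟩ := List.cons.inj h1
      exact (ih h').cons hc

lemma IsGradedPoset.rank_eq_of_covBy [BoundedOrder P] [Finite P] (hP : IsGradedPoset P)
    {a b : P} (h : a ⋖ b) : rank b = rank a + 1 := by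
  obtain ⟨l, hl⟩ := exists_isMaximalChain (bot_le : ⊥ ≤ a)
  have h1 := hP a l hl
  have h2 := hP b _ (hl.append_covBy h)
  simp at h2
  omega

/-- Strict monotonicity of r bounds the height from above; descending through covers bounds it from
below. This is what identifies the poset rank of a flat with its matroid rank. -/
lemma rank_eq_of_covBy_succ [BoundedOrder P] [Finite P] {r : P → ℕ} (h0 : r ⊥ = 0)
    (hr : ∀ a b, a ⋖ b → r b = r a + 1) : (rank : P → ℕ) = r := by
  have hmono : StrictMono r := by
    intro a b hab
    induction a using WellFoundedGT.induction with
    | ind a ih =>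
      obtain ⟨c, hac, hcb⟩ := exists_covBy_le_of_lt hab
      rcases hcb.eq_or_lt with rfl | hlt
      · have := hr _ _ hac; omega
      · have := hr _ _ hac; have := ih c hac.lt hlt; omega
  funext a
  apply le_antisymm
  · have h1 : Order.height a ≤ (r a : ℕ∞) := by
      have := Order.height_le_height_apply_of_strictMono r hmono a
      simpa using this
    rw [rank]
    exact ENat.toNat_le_of_le_natCast h1
  · induction a using WellFoundedLT.induction with
    | ind a ih =>
      rcases (bot_le : ⊥ ≤ a).eq_or_lt with rfl | hlt
      · omega
      · obtain ⟨c, _, hca⟩ := exists_le_covBy_of_lt hlt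
        have h1 := ih c hca.lt
        have h2 := rank_strictMono hca.lt
        have h3 := hr _ _ hca
        omega

lemma isGradedPoset_of_covBy_succ [BoundedOrder P] [Finite P] {r : P → ℕ} (h0 : r ⊥ = 0)
    (hr : ∀ a b, a ⋖ b → r b = r a + 1) : IsGradedPoset P := by
  intro a l hl
  rw [rank_eq_of_covBy_succ h0 hr]
  suffices ∀ (l : List P) (c : P), IsMaximalChain c a l → l.length + r c = r a + 1 by
    have := this l _ hl
    omega
  intro l
  induction l with
  | nil => intro c hl; simp [IsMaximalChain] at hl
  | cons d l ih =>
    intro c hl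
    rcases hl.eq_singleton_or_exists_cons with ⟨h1, rfl⟩ | ⟨a', l', h1, hc, h'⟩
    · rw [h1, List.length_singleton, add_comm]
    · obtain ⟨rfl, rfl⟩ := List.cons.inj h1
      have h2 := ih _ h'
      have h3 := hr _ _ hc
      rw [List.length_cons]
      omega

end Rank

/-! ### Recursion for the Chow polynomial of a finite poset -/

section Recursion

variable {P : Type*} [PartialOrder P] [Fintype P]

open scoped Classical in
lemma sum_mobius_right (a b : P) :
    ∑ F : P with a ≤ F ∧ F ≤ b, mobius a F = if a = b then 1 else 0 := by
  let _ : LocallyFiniteOrder P := Fintype.toLocallyFiniteOrder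
  rw [← IncidenceAlgebra.sum_Icc_mu_right (𝕜 := ℤ) a b]
  refine Finset.sum_congr (by ext; simp) fun F _ => rfl

open scoped Classical in
lemma sum_mobius_left (a b : P) :
    ∑ F : P with a ≤ F ∧ F ≤ b, mobius F b = if a = b then 1 else 0 := by
  let _ : LocallyFiniteOrder P := Fintype.toLocallyFiniteOrder
  rw [← IncidenceAlgebra.sum_Icc_mu_left (𝕜 := ℤ) a b]
  refine Finset.sum_congr (by ext; simp) fun F _ => rfl

lemma charPoly_self (a : P) : charPoly a a = 1 := by
  classical
  have h : mobius a a = 1 := by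
    have := sum_mobius_right a a
    rwa [if_pos rfl, show ({F : P | a ≤ F ∧ F ≤ a} : Finset P) = {a} by
      ext; simp [le_antisymm_iff, and_comm], Finset.sum_singleton] at this
  rw [charPoly, show ({F : P | a ≤ F ∧ F ≤ a} : Finset P) = {a} by
      ext; simp [le_antisymm_iff, and_comm], Finset.sum_singleton, h]
  simp

lemma X_sub_one_mul_redCharPoly {a b : P} (h : a < b) :
    (X - 1) * redCharPoly a b = charPoly a b := by
  classical
  rw [redCharPoly, ← C_1, mul_divByMonic_eq_iff_isRoot, IsRoot, charPoly, eval_finsetSum]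
  have := sum_mobius_right a b
  rw [if_neg h.ne] at this
  simpa using this

open scoped Classical in
-- After exchanging the sums, X^(rk b − rk F) carries the coefficient ∑_{e ≤ a ≤ F} μ(a, F), which
-- vanishes unless F = e.
lemma sum_charPoly (e b : P) (heb : e ≤ b) :
    ∑ a : P with e ≤ a ∧ a ≤ b, charPoly a b = X ^ (rank b - rank e) := by
  have h1 : ∀ a : P, charPoly a b =
      ∑ F : P, if a ≤ F ∧ F ≤ b then C (mobius a F) * X ^ (rank b - rank F) else 0 :=
    fun a => by rw [charPoly, Finset.sum_filter]
  rw [Finset.sum_congr rfl fun a _ => h1 a, Finset.sum_comm]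
  have h2 : ∀ F : P, (∑ a : P with e ≤ a ∧ a ≤ b,
      if a ≤ F ∧ F ≤ b then C (mobius a F) * X ^ (rank b - rank F) else 0) =
      if F ≤ b then C (if e = F then 1 else 0) * X ^ (rank b - rank F) else 0 := by
    intro F
    by_cases hF : F ≤ b
    · rw [if_pos hF, ← sum_mobius_left, map_sum, Finset.sum_mul, Finset.sum_filter,
        Finset.sum_filter]
      refine Finset.sum_congr rfl fun a _ => ?_
      by_cases h : e ≤ a <;> by_cases h' : a ≤ F <;> simp [h, h', hF]
      intro h3; exact absurd (h'.trans hF) h3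
    · simp [hF]
  rw [Finset.sum_congr rfl fun F _ => h2 F, Finset.sum_eq_single e]
  · simp [heb]
  · intro F _ hF
    simp [Ne.symm hF]
  · simp

lemma mem_chainsFromTo {a b : P} {s : Finset P} : s ∈ chainsFromTo a b ↔
    IsChain (· ≤ ·) (s : Set P) ∧ a ∈ s ∧ b ∈ s ∧ ∀ z ∈ s, a ≤ z ∧ z ≤ b := by
  classical
  simp [chainsFromTo]

open scoped Classical in
-- A new minimum creates exactly one new pair of consecutive elements.
lemma chainRedCharPoly_insert {a b : P} (hab : a < b) {s : Finset P} (hb : b ∈ s)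
    (hs : ∀ z ∈ s, b ≤ z) :
    chainRedCharPoly (insert a s) = redCharPoly a b * chainRedCharPoly s := by
  have ha : a ∉ s := fun h => (hab.trans_le (hs a h)).false
  rw [chainRedCharPoly, chainRedCharPoly]
  rw [← Finset.prod_insert (f := fun p : P × P => redCharPoly p.1 p.2) (a := (a, b))]
  · congr 1
    ext ⟨p, q⟩
    simp only [Finset.mem_filter, Finset.mem_product, Finset.mem_insert, Prod.mk.injEq]
    constructor
    · rintro ⟨⟨hp | hp, hq | hq⟩, hpq, h⟩
      · exact absurd (hp.trans hq.symm) hpq.ne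
      · left
        refine ⟨hp, ?_⟩
        by_contra hne
        exact h b (Or.inr hb) ⟨hp ▸ hab, lt_of_le_of_ne (hs q hq) (Ne.symm hne)⟩
      · exact absurd (hpq.trans (hq ▸ hab.trans_le (hs p hp))) (lt_irrefl _)
      · exact Or.inr ⟨⟨hp, hq⟩, hpq, fun z hz => h z (Or.inr hz)⟩
    · rintro (⟨rfl, rfl⟩ | ⟨⟨hp, hq⟩, hpq, h⟩)
      · refine ⟨⟨Or.inl rfl, Or.inr hb⟩, hab, ?_⟩
        rintro z (rfl | hz) h
        · exact h.1.false
        · exact (h.2.trans_le (hs z hz)).false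
      · refine ⟨⟨Or.inr hp, Or.inr hq⟩, hpq, ?_⟩
        rintro z (rfl | hz) h'
        · exact (h'.1.trans (hab.trans_le (hs p hp))).false
        · exact h z hz h'
  · simp [ha]

/-- `X + X^2 + ⋯ + X^m`. -/
noncomputable def truncGeom (m : ℕ) : ℤ[X] := ∑ i ∈ Finset.range m, X ^ (i + 1)

lemma truncGeom_zero : truncGeom 0 = 0 := by simp [truncGeom]

lemma truncGeom_succ (m : ℕ) : truncGeom (m + 1) = X * (1 + truncGeom m) := by
  rw [truncGeom, Finset.sum_range_succ', truncGeom, mul_add, Finset.mul_sum, add_comm]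
  simp [pow_succ']

lemma truncGeom_succ' (m : ℕ) : truncGeom (m + 1) = truncGeom m + X ^ (m + 1) := by
  rw [truncGeom, Finset.sum_range_succ, truncGeom]

lemma X_sub_one_mul_truncGeom (m : ℕ) : (X - 1) * truncGeom m = X ^ (m + 1) - X := by
  induction m with
  | zero => simp [truncGeom]
  | succ m ih =>
    rw [truncGeom_succ', mul_add, ih]
    ring

lemma rank_sub_rank_pos {a b : P} (h : a < b) : 0 < rank b - rank a :=
  Nat.sub_pos_of_lt (rank_strictMono h)

variable [BoundedOrder P]

/-- The Chow polynomial of the interval `[a, ⊤]`, as a sum over chains. -/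
noncomputable def upperChowPoly (a : P) : ℤ[X] := ∑ s ∈ chainsFromTo a ⊤, chainRedCharPoly s

lemma upperChowPoly_top : upperChowPoly (⊤ : P) = 1 := by
  classical
  have : chainsFromTo (⊤ : P) ⊤ = {{⊤}} := by
    ext s
    rw [mem_chainsFromTo, Finset.mem_singleton]
    constructor
    · rintro ⟨_, h, _, h'⟩
      ext z
      rw [Finset.mem_singleton]
      exact ⟨fun hz => top_le_iff.1 (h' z hz).1, fun hz => hz ▸ h⟩
    · rintro rfl
      simp
  rw [upperChowPoly, this, Finset.sum_singleton, chainRedCharPoly, Finset.prod_eq_one]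
  rintro ⟨p, q⟩ hp
  simp only [Finset.mem_filter, Finset.mem_product, Finset.mem_singleton] at hp
  obtain ⟨⟨rfl, rfl⟩, h, _⟩ := hp
  exact absurd h (lt_irrefl _)

open scoped Classical in
-- A chain starting at a ≠ ⊤ is a followed by a chain starting at its second element b.
lemma upperChowPoly_eq_sum {a : P} (ha : a ≠ ⊤) :
    upperChowPoly a = ∑ b : P with a < b, redCharPoly a b * upperChowPoly b := by
  simp only [upperChowPoly, Finset.mul_sum]
  rw [Finset.sum_sigma', eq_comm]
  have key : ∀ x ∈ Finset.sigma (Finset.univ.filter fun b : P => a < b)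
      (fun b => chainsFromTo b ⊤), a < x.1 ∧ x.1 ∈ x.2 ∧ (∀ z ∈ x.2, x.1 ≤ z) := by
    rintro ⟨b, s⟩ h
    simp only [Finset.mem_sigma, Finset.mem_filter, Finset.mem_univ, true_and,
      mem_chainsFromTo] at h
    exact ⟨h.1, h.2.2.1, fun z hz => (h.2.2.2.2 z hz).1⟩
  refine Finset.sum_bij (fun x _ => insert a x.2) ?_ ?_ ?_ ?_
  · rintro ⟨b, s⟩ h
    obtain ⟨h1, -, -⟩ := key _ h
    simp only [Finset.mem_sigma, Finset.mem_filter, Finset.mem_univ, true_and,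
      mem_chainsFromTo] at h ⊢
    obtain ⟨-, hs, hb, ht, hz⟩ := h
    refine ⟨?_, Finset.mem_insert_self _ _, Finset.mem_insert_of_mem ht, ?_⟩
    · rw [Finset.coe_insert]
      exact hs.insert fun z hz' _ => Or.inl (h1.le.trans (hz z hz').1)
    · intro z hz'
      rcases Finset.mem_insert.1 hz' with rfl | hz'
      · exact ⟨le_rfl, le_top⟩
      · exact ⟨h1.le.trans (hz z hz').1, le_top⟩
  · rintro ⟨b, s⟩ h ⟨b', s'⟩ h' heq
    obtain ⟨h1, h2, h3⟩ := key _ h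
    obtain ⟨h1', h2', h3'⟩ := key _ h'
    dsimp only at *
    have hs : s = s' := by
      rw [← Finset.erase_insert (s := s) (a := a) fun h => (h1.trans_le (h3 a h)).false,
        ← Finset.erase_insert (s := s') (a := a) fun h => (h1'.trans_le (h3' a h)).false, heq]
    subst hs
    obtain rfl : b = b' := le_antisymm (h3 _ h2') (h3' _ h2)
    rfl
  · intro t ht
    obtain ⟨hc, hat, htt, hz⟩ := mem_chainsFromTo.1 ht
    have hne : (t.erase a).Nonempty := ⟨⊤, Finset.mem_erase.2 ⟨Ne.symm ha, htt⟩⟩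
    obtain ⟨b, hb⟩ := (t.erase a).exists_minimal hne
    have hbt := Finset.mem_erase.1 hb.1
    have hmin : ∀ z ∈ t.erase a, b ≤ z := by
      intro z hz'
      rcases hc.total hbt.2 (Finset.mem_of_mem_erase hz') with h | h
      · exact h
      · exact hb.2 hz' h
    refine ⟨⟨b, t.erase a⟩, ?_, Finset.insert_erase hat⟩
    simp only [Finset.mem_sigma, Finset.mem_filter, Finset.mem_univ, true_and,
      mem_chainsFromTo]
    exact ⟨lt_of_le_of_ne (hz b hbt.2).1 (Ne.symm hbt.1), hc.mono (by simp), hb.1,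
      Finset.mem_erase.2 ⟨Ne.symm ha, htt⟩, fun z hz' => ⟨hmin z hz', le_top⟩⟩
  · rintro ⟨b, s⟩ h
    obtain ⟨h1, h2, h3⟩ := key _ h
    exact (chainRedCharPoly_insert h1 h2 h3).symm

open scoped Classical in
-- Summing X H_a = ∑_{b ≥ a} χ_{[a,b]} H_b over all a ≥ e lets `sum_charPoly` eliminate the
-- characteristic polynomials; division by X − 1 then turns X^m − X into the truncated geometric
-- sum.
theorem upperChowPoly_eq_one_add_sum (e : P) :
    upperChowPoly e =
      1 + ∑ b : P with e < b, truncGeom (rank b - rank e - 1) * upperChowPoly b := by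
  -- At a = ⊤ the sum is 1 while the left side is X, whence the correction X − 1; this becomes the
  -- summand 1 of the recursion.
  have h1 : ∀ a : P, X * upperChowPoly a =
      (∑ b : P with a ≤ b, charPoly a b * upperChowPoly b) + if a = ⊤ then X - 1 else 0 := by
    intro a
    have hsplit : ({b : P | a ≤ b} : Finset P) = insert a ({b : P | a < b} : Finset P) := by
      ext b
      simp [le_iff_eq_or_lt, eq_comm]
    rw [hsplit, Finset.sum_insert (by simp), charPoly_self]
    by_cases ha : a = ⊤
    · subst ha
      simp [upperChowPoly_top]
    · rw [if_neg ha, add_zero, one_mul]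
      have h2 : ∑ b : P with a < b, charPoly a b * upperChowPoly b =
          (X - 1) * upperChowPoly a := by
        rw [upperChowPoly_eq_sum ha, Finset.mul_sum]
        refine Finset.sum_congr rfl fun b hb => ?_
        rw [← X_sub_one_mul_redCharPoly (Finset.mem_filter.1 hb).2, mul_assoc]
      rw [h2]
      ring
  have h3 : ∑ a : P with e ≤ a, X * upperChowPoly a =
      (∑ b : P with e ≤ b, X ^ (rank b - rank e) * upperChowPoly b) + (X - 1) := by
    rw [Finset.sum_congr rfl fun a _ => h1 a, Finset.sum_add_distrib]
    congr 1
    · have h4 : ∀ b : P, e ≤ b → X ^ (rank b - rank e) * upperChowPoly b =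
          ∑ a : P with e ≤ a ∧ a ≤ b, charPoly a b * upperChowPoly b := by
        intro b hb
        rw [← sum_charPoly e b hb, Finset.sum_mul]
      rw [Finset.sum_congr rfl fun b hb => h4 b (Finset.mem_filter.1 hb).2]
      refine Finset.sum_comm' fun a b => ?_
      simp only [Finset.mem_filter, Finset.mem_univ, true_and]
      exact ⟨fun h => ⟨h, h.1.trans h.2⟩, fun h => h.1⟩
    · rw [Finset.sum_eq_single_of_mem ⊤ (by simp)]
      · simp
      · intro b _ hb
        simp [hb]
  have hsplit : ({b : P | e ≤ b} : Finset P) = insert e ({b : P | e < b} : Finset P) := by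
    ext b
    simp [le_iff_eq_or_lt, eq_comm]
  rw [hsplit, Finset.sum_insert (by simp), Finset.sum_insert (by simp), Nat.sub_self,
    pow_zero, one_mul] at h3
  have hX : (X - 1 : ℤ[X]) ≠ 0 := by
    rw [← C_1]
    exact X_sub_C_ne_zero 1
  apply mul_left_cancel₀ hX
  have h5 : (X - 1) * ∑ b : P with e < b, truncGeom (rank b - rank e - 1) * upperChowPoly b =
      (∑ b : P with e < b, X ^ (rank b - rank e) * upperChowPoly b) -
        ∑ b : P with e < b, X * upperChowPoly b := by
    rw [Finset.mul_sum, ← Finset.sum_sub_distrib]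
    refine Finset.sum_congr rfl fun b hb => ?_
    have := rank_sub_rank_pos (Finset.mem_filter.1 hb).2
    rw [← mul_assoc, X_sub_one_mul_truncGeom, Nat.sub_add_cancel this, sub_mul]
  rw [mul_add, h5]
  linear_combination h3

lemma chowPoly_eq_upperChowPoly : chowPoly P = upperChowPoly (⊥ : P) := rfl

/-- The recursion at ⊥ expands the term of a = ⊥; the terms X^(rk b) H_b for b > ⊥ then lengthen
each geometric sum by one. -/
theorem augChowPoly_eq_one_add_sum :
    augChowPoly P = 1 + ∑ b : P, truncGeom (rank b) * upperChowPoly b := by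
  classical
  have h1 : augChowPoly P = ∑ b : P, X ^ rank b * upperChowPoly b := by
    simp only [augChowPoly, upperChowPoly, Finset.mul_sum]
  have h2 := upperChowPoly_eq_one_add_sum (⊥ : P)
  have hsplit : (Finset.univ : Finset P) = insert ⊥ ({b : P | ⊥ < b} : Finset P) := by
    ext b
    simp [bot_lt_iff_ne_bot, em]
  rw [h1, hsplit, Finset.sum_insert (by simp), Finset.sum_insert (by simp), rank_bot,
    truncGeom_zero, pow_zero, one_mul, zero_mul, zero_add, h2, add_assoc,
    ← Finset.sum_add_distrib]
  congr 1
  refine Finset.sum_congr rfl fun b hb => ?_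
  obtain ⟨m, hm⟩ : ∃ m, rank b = m + 1 := by
    have := rank_sub_rank_pos (Finset.mem_filter.1 hb).2
    rw [rank_bot] at this
    exact ⟨rank b - 1, by omega⟩
  rw [rank_bot, hm, truncGeom_succ']
  simp only [Nat.sub_zero, Nat.add_sub_cancel]
  ring

end Recursion

/-! ### Weights of label sequences -/

/-- Whether the first letter of the word is smaller than `b`. -/
def startsBelow (b : ℕ) : List ℕ → Bool
  | [] => false
  | c :: _ => decide (c < b)

/-- The weight of a word with `n` letters and `k` descents: it is `X^k (X+1)^(n-1-2k)` if no two
descents are adjacent and the word does not begin with a descent, and `0` otherwise. -/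
noncomputable def wordWeight : List ℕ → ℤ[X]
  | [] => 1
  | [_] => 1
  | a :: b :: w => if a ≤ b then
      (X + 1) * wordWeight (b :: w) + (if startsBelow b w then X * wordWeight w else 0) else 0

lemma wordWeight_mem_gammaCone : ∀ w : List ℕ, wordWeight w ∈ gammaCone (w.length - 1)
  | [] => by simpa [wordWeight] using one_mem_gammaCone
  | [_] => by simpa [wordWeight] using one_mem_gammaCone
  | a :: b :: w => by
    rw [wordWeight]
    split_ifs with hab hb
    · refine add_mem ?_ ?_
      · simpa using X_add_one_mul_mem_gammaCone (wordWeight_mem_gammaCone (b :: w))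
      · have := X_mul_mem_gammaCone (wordWeight_mem_gammaCone w)
        cases w with
        | nil => simp [startsBelow] at hb
        | cons c w => simpa using this
    · simpa using X_add_one_mul_mem_gammaCone (wordWeight_mem_gammaCone (b :: w))
    · exact zero_mem _

/-- The sum, over the weakly increasing prefixes of `w` with letters at least `l`, of
`X + ⋯ + X^(k+j)` times the weight of the rest of the word, where `j` is the length of the prefix;
with an additional `1` if all of `w` is such a prefix. -/
noncomputable def prefixSum (k l : ℕ) : List ℕ → ℤ[X]
  | [] => truncGeom k + 1
  | b :: w => truncGeom k * wordWeight (b :: w) + if l ≤ b then prefixSum (k + 1) b w else 0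

/-- With t = `truncGeom k` and l ≤ b, the contributions t and 1 + X(1 + t) to the coefficient of
`wordWeight (b :: w)` add up to (1 + t)(1 + X), and a descent from b to w contributes X(1 + t): this
is 1 + t times the recursion of `wordWeight`. The case k = 0 is the one wanted; general k is needed
for the induction. -/
lemma prefixSum_eq (k l : ℕ) (w : List ℕ) :
    prefixSum k l w = (1 + truncGeom k) * wordWeight (l :: w) +
      if startsBelow l w then truncGeom k * wordWeight w else 0 := by
  induction w generalizing k l with
  | nil => simp [prefixSum, wordWeight, startsBelow, add_comm]
  | cons b w ih =>
    rw [prefixSum, ih, wordWeight, startsBelow, truncGeom_succ]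
    by_cases h : l ≤ b
    · rw [if_pos h, if_pos h, decide_eq_false (not_lt.2 h), if_neg Bool.false_ne_true]
      split_ifs
      · ring
      · ring
    · rw [if_neg h, if_neg h, if_pos (decide_eq_true (not_le.1 h))]
      ring

lemma prefixSum_zero (l : ℕ) : prefixSum 0 l = fun w => wordWeight (l :: w) := by
  funext w
  simp [prefixSum_eq, truncGeom_zero]

/-! ### Sums over maximal chains, and R-labelings -/

section RLabeling

lemma labels_cons_cons {P : Type*} (lab : P → P → ℕ) (a b : P) (L : List P) :
    labels lab (a :: b :: L) = lab a b :: labels lab (b :: L) := rfl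

variable {P : Type*} [PartialOrder P]

/-- There is a maximal chain from `a` to `b` with weakly increasing labels, all at least `l`. -/
def HasIncreasingChain (lab : P → P → ℕ) (l : ℕ) (a b : P) : Prop :=
  ∃ L, IsMaximalChain a b L ∧ (l :: labels lab L).IsChain (· ≤ ·)

lemma hasIncreasingChain_iff {lab : P → P → ℕ} {l : ℕ} {a b : P} :
    HasIncreasingChain lab l a b ↔
      a = b ∨ ∃ a', (a ⋖ a' ∧ l ≤ lab a a') ∧ HasIncreasingChain lab (lab a a') a' b := by
  constructor
  · rintro ⟨L, h1, h2⟩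
    rcases h1.eq_singleton_or_exists_cons with ⟨-, h⟩ | ⟨a', L', rfl, hc, h'⟩
    · exact Or.inl h
    · rw [labels_cons_cons, List.isChain_cons_cons] at h2
      exact Or.inr ⟨a', ⟨hc, h2.1⟩, _, h', h2.2⟩
  · rintro (rfl | ⟨a', ⟨h1, h2⟩, L, h3, h4⟩)
    · exact ⟨[a], isMaximalChain_singleton a, by simp [labels]⟩
    · refine ⟨_, h3.cons h1, ?_⟩
      obtain ⟨L', rfl⟩ : ∃ L', L = a' :: L' := by
        rcases h3.eq_singleton_or_exists_cons with ⟨h, -⟩ | ⟨_, L', h, -⟩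
        exacts [⟨_, h⟩, ⟨_, h⟩]
      rw [labels_cons_cons, List.isChain_cons_cons]
      exact ⟨h2, h4⟩

lemma HasIncreasingChain.le {lab : P → P → ℕ} {l : ℕ} {a b : P}
    (h : HasIncreasingChain lab l a b) : a ≤ b := h.choose_spec.1.le

lemma IsRLabeling.hasIncreasingChain_zero {lab : P → P → ℕ} (hlab : IsRLabeling lab) {a b : P} :
    HasIncreasingChain lab 0 a b ↔ a ≤ b := by
  refine ⟨HasIncreasingChain.le, fun h => ?_⟩
  obtain ⟨L, ⟨h1, h2⟩, -⟩ := hlab a b h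
  refine ⟨L, h1, ?_⟩
  cases hL : labels lab L with
  | nil => simp
  | cons x t => exact List.IsChain.cons_cons (Nat.zero_le _) (hL ▸ h2)

/-- Both chains extend to increasing maximal chains of [a, b], which is unique, so their second
elements agree. -/
lemma IsRLabeling.eq_of_hasIncreasingChain {lab : P → P → ℕ} (hlab : IsRLabeling lab)
    {a a' a'' b : P} (h : a ⋖ a') (hi : HasIncreasingChain lab (lab a a') a' b)
    (h' : a ⋖ a'') (hi' : HasIncreasingChain lab (lab a a'') a'' b) : a' = a'' := by
  have key : ∀ c, a ⋖ c → HasIncreasingChain lab (lab a c) c b →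
      ∃ L, IsMaximalChain a b (a :: c :: L) ∧ (labels lab (a :: c :: L)).IsChain (· ≤ ·) := by
    rintro c hc ⟨L, h1, h2⟩
    obtain ⟨L', rfl⟩ : ∃ L', L = c :: L' := by
      rcases h1.eq_singleton_or_exists_cons with ⟨h, -⟩ | ⟨_, L', h, -⟩
      exacts [⟨_, h⟩, ⟨_, h⟩]
    exact ⟨L', h1.cons hc, h2⟩
  obtain ⟨L, hL⟩ := key a' h hi
  obtain ⟨L', hL'⟩ := key a'' h' hi'
  have := (hlab a b (h.le.trans hi.le)).unique hL hL'
  simp only [List.cons.injEq, true_and] at this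
  exact this.1

variable [Fintype P]

open scoped Classical in
-- Each b ≠ a that can be reached is reached through only one cover a', so splitting by the first
-- step counts nothing twice.
lemma IsRLabeling.sum_hasIncreasingChain {lab : P → P → ℕ} (hlab : IsRLabeling lab) (l : ℕ)
    (a : P) (f : P → ℤ[X]) :
    ∑ b : P with HasIncreasingChain lab l a b, f b = f a +
      ∑ a' : P with a ⋖ a' ∧ l ≤ lab a a',
        ∑ b : P with HasIncreasingChain lab (lab a a') a' b, f b := by
  have h1 : ∀ b, (if HasIncreasingChain lab l a b then f b else 0) =
      (if a = b then f b else 0) + ∑ a' : P with a ⋖ a' ∧ l ≤ lab a a',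
        if HasIncreasingChain lab (lab a a') a' b then f b else 0 := by
    intro b
    by_cases hab : a = b
    · rw [if_pos hab, if_pos (hasIncreasingChain_iff.2 (Or.inl hab)), Finset.sum_eq_zero,
        add_zero]
      intro c hc
      rw [if_neg]
      intro h
      exact ((Finset.mem_filter.1 hc).2.1.lt.trans_le h.le).ne hab
    · rw [if_neg hab, zero_add]
      by_cases h : HasIncreasingChain lab l a b
      · rw [if_pos h]
        obtain ⟨c, hc, hcb⟩ := (hasIncreasingChain_iff.1 h).resolve_left hab
        rw [Finset.sum_eq_single_of_mem c (by simpa using hc), if_pos hcb]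
        intro d hd hdc
        rw [if_neg]
        intro hdb
        exact hdc (hlab.eq_of_hasIncreasingChain (Finset.mem_filter.1 hd).2.1 hdb hc.1 hcb)
      · rw [if_neg h, Finset.sum_eq_zero]
        intro c hc
        rw [if_neg]
        intro hcb
        exact h (hasIncreasingChain_iff.2 (Or.inr ⟨c, (Finset.mem_filter.1 hc).2, hcb⟩))
  rw [Finset.sum_filter, Finset.sum_congr rfl fun b _ => h1 b, Finset.sum_add_distrib,
    Finset.sum_comm]
  simp [Finset.sum_filter]

variable [BoundedOrder P]

open scoped Classical in
/-- The sum of `φ` over the label sequences of all maximal chains from `a` to `⊤`. -/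
noncomputable def labelSum (lab : P → P → ℕ) : P → (List ℕ → ℤ[X]) → ℤ[X] :=
  -- The function φ varies in the recursion: each step of the chain absorbs one label into it.
  (wellFounded_gt (α := P)).fix fun a ih φ =>
    if a = ⊤ then φ [] else
      ∑ a' : P, if h : a ⋖ a' then ih a' h.lt (fun w => φ (lab a a' :: w)) else 0

lemma labelSum_top (lab : P → P → ℕ) (φ : List ℕ → ℤ[X]) : labelSum lab ⊤ φ = φ [] := by
  rw [labelSum, WellFounded.fix_eq, if_pos rfl]

open scoped Classical in
lemma labelSum_of_ne_top (lab : P → P → ℕ) {a : P} (ha : a ≠ ⊤) (φ : List ℕ → ℤ[X]) :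
    labelSum lab a φ = ∑ a' : P with a ⋖ a', labelSum lab a' fun w => φ (lab a a' :: w) := by
  rw [labelSum, WellFounded.fix_eq, if_neg ha, Finset.sum_filter]
  refine Finset.sum_congr rfl fun a' _ => ?_
  split_ifs <;> rfl

lemma labelSum_add (lab : P → P → ℕ) (a : P) (φ ψ : List ℕ → ℤ[X]) :
    labelSum lab a (fun w => φ w + ψ w) = labelSum lab a φ + labelSum lab a ψ := by
  classical
  induction a using WellFoundedGT.induction generalizing φ ψ with
  | ind a ih =>
    by_cases ha : a = ⊤
    · subst ha
      simp only [labelSum_top]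
    · simp only [labelSum_of_ne_top lab ha]
      rw [← Finset.sum_add_distrib]
      exact Finset.sum_congr rfl fun b hb => ih b (Finset.mem_filter.1 hb).2.lt _ _

lemma labelSum_mul_left (lab : P → P → ℕ) (a : P) (c : ℤ[X]) (φ : List ℕ → ℤ[X]) :
    labelSum lab a (fun w => c * φ w) = c * labelSum lab a φ := by
  classical
  induction a using WellFoundedGT.induction generalizing φ with
  | ind a ih =>
    by_cases ha : a = ⊤
    · subst ha
      simp only [labelSum_top]
    · simp only [labelSum_of_ne_top lab ha]
      rw [Finset.mul_sum]
      exact Finset.sum_congr rfl fun b hb => ih b (Finset.mem_filter.1 hb).2.lt _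

/-- In a graded poset all words that occur have length rk ⊤ − rk a. -/
lemma IsGradedPoset.labelSum_mem (hP : IsGradedPoset P) (lab : P → P → ℕ)
    (S : AddSubmonoid ℤ[X]) (a : P) (φ : List ℕ → ℤ[X])
    (hφ : ∀ w : List ℕ, w.length + rank a = rank (⊤ : P) → φ w ∈ S) : labelSum lab a φ ∈ S := by
  classical
  induction a using WellFoundedGT.induction generalizing φ with
  | ind a ih =>
    by_cases ha : a = ⊤
    · subst ha
      rw [labelSum_top]
      exact hφ [] (by simp)
    · rw [labelSum_of_ne_top lab ha]
      refine sum_mem fun b hb => ?_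
      have hab := (Finset.mem_filter.1 hb).2
      refine ih b hab.lt _ fun w hw => hφ _ ?_
      rw [← hw, hP.rank_eq_of_covBy hab, List.length_cons]
      ring

open scoped Classical in
-- Double counting of maximal chains with a marked increasing initial segment: by the chain on the
-- left, by the end b of the segment on the right. The segment has length rk b − rk a, and b = ⊤
-- accounts for the extra 1 of `prefixSum`.
lemma labelSum_prefixSum (hP : IsGradedPoset P) {lab : P → P → ℕ} (hlab : IsRLabeling lab)
    (a : P) (k l : ℕ) :
    labelSum lab a (prefixSum k l) = ∑ b : P with HasIncreasingChain lab l a b,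
      (truncGeom (k + rank b - rank a) * labelSum lab b wordWeight + if b = ⊤ then 1 else 0) := by
  induction a using WellFoundedGT.induction generalizing k l with
  | ind a ih =>
    by_cases ha : a = ⊤
    · subst ha
      rw [labelSum_top, show ({b : P | HasIncreasingChain lab l ⊤ b} : Finset P) = {⊤} by
        ext b
        simp only [Finset.mem_filter, Finset.mem_univ, true_and, Finset.mem_singleton]
        exact ⟨fun h => top_le_iff.1 h.le, fun h => hasIncreasingChain_iff.2 (Or.inl h.symm)⟩]
      simp [prefixSum, labelSum_top, wordWeight]
    · rw [hlab.sum_hasIncreasingChain, if_neg ha, add_zero, labelSum_of_ne_top lab ha,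
        Nat.add_sub_cancel, labelSum_of_ne_top lab ha, Finset.mul_sum, ← Finset.filter_filter,
        Finset.sum_filter (p := fun a' => l ≤ lab a a'), ← Finset.sum_add_distrib]
      refine Finset.sum_congr rfl fun a' ha' => ?_
      have hcov := (Finset.mem_filter.1 ha').2
      simp only [prefixSum]
      rw [labelSum_add, labelSum_mul_left]
      congr 1
      split_ifs
      · rw [ih a' hcov.lt]
        refine Finset.sum_congr rfl fun b _ => ?_
        rw [hP.rank_eq_of_covBy hcov, show k + 1 + rank b - (rank a + 1) = k + rank b - rank a by
          omega]
      -- Here the prefix cannot be extended and the summand is the zero function, a multiple by the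
      -- scalar 0.
      · simpa using labelSum_mul_left lab a' 0 0

open scoped Classical in
-- The first cover a' is split off and the weight of the word `lab a a' :: w` is read as `prefixSum
-- 0 (lab a a') w`; the increasing chains counted are then those from a through a'.
lemma labelSum_wordWeight_eq_one_add_sum (hP : IsGradedPoset P) {lab : P → P → ℕ}
    (hlab : IsRLabeling lab) (a : P) :
    labelSum lab a wordWeight = 1 +
      ∑ b : P with a < b, truncGeom (rank b - rank a - 1) * labelSum lab b wordWeight := by
  by_cases ha : a = ⊤
  · subst ha
    simp [labelSum_top, wordWeight]
  · have h := hlab.sum_hasIncreasingChain 0 a fun b =>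
      truncGeom (rank b - rank a - 1) * labelSum lab b wordWeight + if b = ⊤ then 1 else 0
    -- At b = a the truncated subtraction gives `truncGeom 0 = 0`, so the term of b = a is harmless.
    simp only [hlab.hasIncreasingChain_zero, Nat.zero_le, and_true, Nat.sub_self, Nat.zero_sub,
      truncGeom_zero, zero_mul, if_neg ha, add_zero, zero_add] at h
    have h2 : labelSum lab a wordWeight = ∑ b : P with a ≤ b,
        (truncGeom (rank b - rank a - 1) * labelSum lab b wordWeight +
          if b = ⊤ then 1 else 0) := by
      rw [h, labelSum_of_ne_top lab ha]
      refine Finset.sum_congr rfl fun a' ha' => ?_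
      rw [← prefixSum_zero, labelSum_prefixSum hP hlab]
      refine Finset.sum_congr rfl fun b _ => ?_
      rw [hP.rank_eq_of_covBy (Finset.mem_filter.1 ha').2, zero_add, Nat.sub_sub]
    have hsplit : ({b : P | a ≤ b} : Finset P) = insert a ({b : P | a < b} : Finset P) := by
      ext b
      simp [le_iff_eq_or_lt, eq_comm]
    rw [h2, Finset.sum_add_distrib, add_comm, hsplit, Finset.sum_insert (by simp),
      Finset.sum_insert (by simp), if_neg ha, Nat.sub_self, Nat.zero_sub, truncGeom_zero,
      zero_mul, zero_add, zero_add]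
    congr 1
    rw [Finset.sum_ite_eq' _ ⊤, if_pos]
    simpa using Ne.lt_top ha

lemma upperChowPoly_eq_labelSum (hP : IsGradedPoset P) {lab : P → P → ℕ}
    (hlab : IsRLabeling lab) (a : P) : upperChowPoly a = labelSum lab a wordWeight := by
  classical
  induction a using WellFoundedGT.induction with
  | ind a ih =>
    rw [upperChowPoly_eq_one_add_sum, labelSum_wordWeight_eq_one_add_sum hP hlab]
    congr 1
    refine Finset.sum_congr rfl fun b hb => ?_
    rw [ih b (Finset.mem_filter.1 hb).2]

/-- The letter 0 lies below every label, so all b, including ⊥, occur as ends of marked segments,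
with the factor `truncGeom (rank b)` of the augmented recursion. -/
lemma augChowPoly_eq_labelSum (hP : IsGradedPoset P) {lab : P → P → ℕ}
    (hlab : IsRLabeling lab) :
    augChowPoly P = labelSum lab ⊥ fun w => wordWeight (0 :: w) := by
  classical
  rw [augChowPoly_eq_one_add_sum, ← prefixSum_zero, labelSum_prefixSum hP hlab]
  simp only [hlab.hasIncreasingChain_zero, bot_le, Finset.filter_true, Finset.sum_add_distrib,
    zero_add, rank_bot, Nat.sub_zero, ← upperChowPoly_eq_labelSum hP hlab]
  rw [add_comm, Finset.sum_ite_eq' _ ⊤, if_pos (Finset.mem_univ _)]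

lemma coeff_zero_truncGeom_mul (m : ℕ) (p : ℤ[X]) : (truncGeom m * p).coeff 0 = 0 := by
  rw [mul_coeff_zero]
  cases m with
  | zero => simp [truncGeom_zero]
  | succ m => simp [truncGeom_succ, mul_coeff_zero]

theorem isGoodOfDegree_chowPoly (hP : IsGradedPoset P) {lab : P → P → ℕ}
    (hlab : IsRLabeling lab) : IsGoodOfDegree (rank (⊤ : P) - 1) (chowPoly P) := by
  classical
  rw [chowPoly_eq_upperChowPoly]
  refine isGoodOfDegree_of_mem_gammaCone ?_ ?_
  · rw [upperChowPoly_eq_labelSum hP hlab]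
    refine hP.labelSum_mem lab _ _ _ fun w hw => ?_
    rw [← hw, rank_bot]
    exact wordWeight_mem_gammaCone w
  · rw [upperChowPoly_eq_one_add_sum, coeff_add, finsetSum_coeff, Finset.sum_eq_zero]
    · simp
    · exact fun b _ => coeff_zero_truncGeom_mul _ _

theorem isGoodOfDegree_augChowPoly (hP : IsGradedPoset P) {lab : P → P → ℕ}
    (hlab : IsRLabeling lab) : IsGoodOfDegree (rank (⊤ : P)) (augChowPoly P) := by
  refine isGoodOfDegree_of_mem_gammaCone ?_ ?_
  · rw [augChowPoly_eq_labelSum hP hlab]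
    refine hP.labelSum_mem lab _ _ _ fun w hw => ?_
    rw [← hw, rank_bot]
    -- The prepended letter raises the degree of the cone from n − 1 to n.
    exact wordWeight_mem_gammaCone (0 :: w)
  · rw [augChowPoly_eq_one_add_sum, coeff_add, finsetSum_coeff, Finset.sum_eq_zero]
    · simp
    · exact fun b _ => coeff_zero_truncGeom_mul _ _

end RLabeling

/-! ### Relations in Chow rings -/

section Relations

variable {P : Type*} [SemilatticeSup P] [Fintype P] {A : Type*} [CommRing A]

open scoped Classical in
/-- The sum of the variables `x H` over all `H ≥ G`. -/
noncomputable def upperSum (x : P → A) (G : P) : A := ∑ H : P with G ≤ H, x H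

lemma map_upperSum {B : Type*} [CommRing B] (f : A →+* B) (x : P → A) (G : P) :
    f (upperSum x G) = upperSum (fun F => f (x F)) G := by
  classical
  rw [upperSum, map_sum, upperSum]

open scoped Classical in
lemma upperSum_sub_upperSum (x : P → A) {F G : P} (h : F ≤ G) :
    upperSum x F - upperSum x G = ∑ H : P with F ≤ H ∧ ¬ G ≤ H, x H := by
  rw [upperSum, upperSum, sub_eq_iff_eq_add, ← Finset.sum_filter_not_add_sum_filter _ (G ≤ ·),
    Finset.filter_filter, Finset.filter_filter]
  congr 2
  ext H
  simp only [Finset.mem_filter, Finset.mem_univ, true_and, and_iff_right_iff_imp]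
  exact h.trans

/-- The relations between the variables `x F` in a Chow ring that hold independently of the
minimal elements of the poset. -/
structure ChainRelations (rk : P → ℕ) (x : P → A) : Prop where
  incomparable : ∀ F G, ¬ F ≤ G → ¬ G ≤ F → x F * x G = 0
  lt : ∀ F G m, F < G → rk G ≤ rk F + m → x F * upperSum x G ^ m = 0

/-- An H ≥ G that is not above F ⊔ G is not above F, nor below F because G ≰ F; so x_F x_H = 0. -/
lemma mul_upperSum_of_incomparable {x : P → A}
    (hx : ∀ F G, ¬ F ≤ G → ¬ G ≤ F → x F * x G = 0) {F G : P} (h : ¬ G ≤ F) :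
    x F * upperSum x G = x F * upperSum x (F ⊔ G) := by
  classical
  rw [← sub_eq_zero, ← mul_sub, upperSum_sub_upperSum x le_sup_right, Finset.mul_sum]
  refine Finset.sum_eq_zero fun H hH => ?_
  obtain ⟨h1, h2⟩ := (Finset.mem_filter.1 hH).2
  exact hx _ _ (fun h3 => h2 (sup_le h3 h1)) fun h3 => h (h1.trans h3)

lemma mul_upperSum_pow_of_incomparable {x : P → A}
    (hx : ∀ F G, ¬ F ≤ G → ¬ G ≤ F → x F * x G = 0) {F G : P} (h : ¬ G ≤ F) (m : ℕ) :
    x F * upperSum x G ^ m = x F * upperSum x (F ⊔ G) ^ m := by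
  induction m with
  | zero => simp
  | succ m ih =>
    rw [pow_succ, ← mul_assoc, ih, mul_right_comm, mul_upperSum_of_incomparable hx h]
    ring

variable {rk : P → ℕ} {x : P → A}

lemma ChainRelations.mul_upperSum_pow (hx : ChainRelations rk x) {F G : P} (h : ¬ G ≤ F) {m : ℕ}
    (hm : rk (F ⊔ G) ≤ rk F + m) : x F * upperSum x G ^ m = 0 := by
  rw [mul_upperSum_pow_of_incomparable hx.incomparable h]
  exact hx.lt _ _ _ (left_lt_sup.2 h) hm

/-- The rank function is submodular above each element. -/
def SubmodularAbove (rk : P → ℕ) : Prop :=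
  ∀ L F G : P, L ≤ F → L ≤ G → rk (F ⊔ G) + rk L ≤ rk F + rk G

/-- The difference h_Z − h_G is the sum of the x_H with H ≥ Z and H ≱ G. Submodularity above Z gives
rk(H ⊔ G) − rk H ≤ rk G − rk Z ≤ m, so x_H h_G^m = 0. -/
lemma ChainRelations.upperSum_mul_upperSum_pow (hx : ChainRelations rk x)
    (hrk : SubmodularAbove rk) {Z G : P} (h : Z ≤ G) {m : ℕ} (hm : rk G ≤ rk Z + m) :
    upperSum x Z * upperSum x G ^ m = upperSum x G ^ (m + 1) := by
  classical
  rw [pow_succ', ← sub_eq_zero, ← sub_mul, upperSum_sub_upperSum x h, Finset.sum_mul]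
  refine Finset.sum_eq_zero fun H hH => ?_
  obtain ⟨h1, h2⟩ := (Finset.mem_filter.1 hH).2
  have := hrk Z H G h1 h
  exact hx.mul_upperSum_pow h2 (by omega)

lemma ChainRelations.upperSum_pow_mul_upperSum_pow (hx : ChainRelations rk x)
    (hrk : SubmodularAbove rk) {Z G : P} (h : Z ≤ G) {m : ℕ} (hm : rk G ≤ rk Z + m) (k : ℕ) :
    upperSum x Z ^ k * upperSum x G ^ m = upperSum x G ^ (k + m) := by
  induction k with
  | zero => simp
  | succ k ih =>
    rw [pow_succ', mul_assoc, ih, hx.upperSum_mul_upperSum_pow hrk h (by omega)]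
    ring

/-- The relations of a Chow ring follow from those for which the exponent is one. -/
lemma chainRelations_of_linear (hmono : StrictMono rk) (hrk : SubmodularAbove rk)
    (hx : ∀ F G, ¬ F ≤ G → ¬ G ≤ F → x F * x G = 0)
    (hlin : ∀ F G, F < G → ∃ Y ≤ G, ¬ Y ≤ F ∧ x F * upperSum x Y = 0) : ChainRelations rk x := by
  classical
  refine ⟨hx, ?_⟩
  intro F G m
  induction m generalizing F G with
  | zero =>
    intro h h'
    have := hmono h
    omega
  | succ m ih =>
    intro h hm
    obtain ⟨Y, hYG, hYF, hY⟩ := hlin F G h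
    -- One factor h_G is replaced by h_Y minus the x_H with H ≥ Y and H ≱ G.
    have h1 : x F * upperSum x G ^ (m + 1) =
        x F * upperSum x Y * upperSum x G ^ m -
          ∑ H : P with Y ≤ H ∧ ¬ G ≤ H, x F * x H * upperSum x G ^ m := by
      simp only [mul_right_comm _ (x _)]
      rw [← Finset.mul_sum, ← upperSum_sub_upperSum x hYG]
      ring
    rw [h1, hY, zero_mul, zero_sub, neg_eq_zero]
    refine Finset.sum_eq_zero fun H hH => ?_
    obtain ⟨hYH, hGH⟩ := (Finset.mem_filter.1 hH).2
    by_cases hFH : F ≤ H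
    · rw [mul_assoc, mul_upperSum_pow_of_incomparable hx hGH]
      -- Since Y ≰ F, the rank of F ⊔ Y exceeds that of F; submodularity above F ⊔ Y therefore
      -- bounds rk(H ⊔ G) − rk H by m.
      have h2 := hrk (F ⊔ Y) H G (sup_le hFH hYH) (sup_le h.le hYG)
      have h3 := hmono (left_lt_sup.2 hYF)
      rw [ih _ _ (left_lt_sup.2 hGH) (by omega), mul_zero]
    · rw [hx F H hFH fun h4 => hYF (hYH.trans h4), zero_mul]

lemma ChainRelations.upperSum_pow_eq_zero (hx : ChainRelations rk x)
    (hrk : SubmodularAbove rk) {Y G : P} (hY : upperSum x Y = 0) (hYG : Y ≤ G) {m : ℕ}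
    (hm : rk G + 1 ≤ rk Y + m) : upperSum x G ^ m = 0 := by
  rcases m with _ | m
  · rcases hYG.eq_or_lt with rfl | h
    · omega
    · have h1 := hrk Y G G hYG hYG
      rw [sup_idem] at h1
      omega
  · rw [← hx.upperSum_mul_upperSum_pow hrk hYG (by omega), hY, zero_mul]

end Relations

/-! ### Adjoining a root -/

section Adjoin

variable {A : Type*} [CommRing A]

/-- Modulo J the polynomial has degree below r and is divisible by a monic polynomial of degree r,
so it vanishes, and so does the cofactor q. Then q(0) ∈ J, and the constant term is q(0) h^r = 0. -/
lemma eq_zero_of_mem_span_sup {J : Ideal A} {h : A} {r n : ℕ} (hn : n < r)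
    (hJ : ∀ a ∈ J, a * h ^ r = 0) (a : A) (b : Fin n → A)
    (hf : C a + ∑ i : Fin n, X ^ (i.1 + 1) * C (b i) ∈
      Ideal.span {(X + C h) ^ r} ⊔ Ideal.span {X} * J.map (C : A →+* A[X])) :
    a = 0 ∧ ∀ i, b i ∈ J := by
  set f := C a + ∑ i : Fin n, X ^ (i.1 + 1) * C (b i) with hfdef
  have hf0 : f.coeff 0 = a := by
    simp [hfdef, finsetSum_coeff, mul_coeff_zero]
  have hfi : ∀ i : Fin n, f.coeff (i.1 + 1) = b i := by
    intro i
    simp only [hfdef, coeff_add, coeff_C_succ, zero_add, finsetSum_coeff, coeff_mul_C, coeff_X_pow]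
    rw [Finset.sum_eq_single i]
    · simp
    · intro j _ hj
      rw [if_neg, zero_mul]
      intro h
      exact hj (Fin.ext (by omega))
    · simp
  have hdeg : f.degree < r := by
    rw [← mem_degreeLT, hfdef]
    refine add_mem ?_ (sum_mem fun i _ => ?_) <;> rw [mem_degreeLT]
    · exact degree_C_le.trans_lt (by exact_mod_cast (by omega : 0 < r))
    · rw [mul_comm]
      refine (degree_C_mul_X_pow_le _ _).trans_lt ?_
      exact_mod_cast (by omega : i.1 + 1 < r)
  obtain ⟨y, hy, t, ht, hyt⟩ := Submodule.mem_sup.1 hf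
  obtain ⟨q, rfl⟩ := Ideal.mem_span_singleton.1 hy
  obtain ⟨t, htJ, rfl⟩ := Ideal.mem_span_singleton_mul.1 ht
  have hmt : t.map (Ideal.Quotient.mk J) = 0 := by
    rw [Ideal.mem_map_C_iff] at htJ
    ext i
    rw [coeff_map, coeff_zero]
    exact Ideal.Quotient.eq_zero_iff_mem.2 (htJ i)
  have hmf : f.map (Ideal.Quotient.mk J) =
      ((X + C h) ^ r).map (Ideal.Quotient.mk J) * q.map (Ideal.Quotient.mk J) := by
    rw [← hyt, Polynomial.map_add, Polynomial.map_mul, Polynomial.map_mul, hmt, mul_zero, add_zero]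
  have hmonic : (((X + C h) ^ r).map (Ideal.Quotient.mk J)).Monic :=
    ((monic_X_add_C h).pow r).map _
  have hmf0 : f.map (Ideal.Quotient.mk J) = 0 := by
    rcases subsingleton_or_nontrivial (A ⧸ J) with hs | hs
    · exact Subsingleton.elim _ _
    by_contra hne
    refine hmonic.not_dvd_of_degree_lt hne ?_ ⟨_, hmf⟩
    refine (degree_map_le).trans_lt (hdeg.trans_le ?_)
    rw [degree_eq_natDegree hmonic.ne_zero, Polynomial.map_pow, Polynomial.map_add, map_X, map_C,
      (monic_X_add_C _).natDegree_pow, natDegree_X_add_C, mul_one]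
  have hcoef : ∀ i, f.coeff i ∈ J := by
    intro i
    rw [← Ideal.Quotient.eq_zero_iff_mem, ← coeff_map, hmf0, coeff_zero]
  have hq : q.map (Ideal.Quotient.mk J) = 0 := by
    rw [hmf0] at hmf
    exact hmonic.mul_right_eq_zero_iff.1 hmf.symm
  refine ⟨?_, fun i => hfi i ▸ hcoef _⟩
  have hq0 : q.coeff 0 ∈ J := by
    rw [← Ideal.Quotient.eq_zero_iff_mem, ← coeff_map, hq, coeff_zero]
  rw [← hf0, ← hyt, coeff_add, mul_coeff_zero, mul_coeff_zero, coeff_X_zero, zero_mul, add_zero,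
    coeff_zero_eq_eval_zero, eval_pow, eval_add, eval_X, eval_C, zero_add, mul_comm, hJ _ hq0]

end Adjoin

/-! ### Graded pieces -/

section GradedPieces

variable {σ : Type*}

open MvPolynomial in
lemma mem_quotientPiece {I : Ideal (MvPolynomial σ ℚ)} {d : ℕ} {y : MvPolynomial σ ℚ ⧸ I} :
    y ∈ quotientPiece I d ↔
      ∃ f : MvPolynomial σ ℚ, f.IsHomogeneous d ∧ Ideal.Quotient.mk I f = y := Iff.rfl

instance [Finite σ] (I : Ideal (MvPolynomial σ ℚ)) (d : ℕ) :
    Module.Finite ℚ (quotientPiece I d) :=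
  Module.Finite.iff_fg.2 ((MvPolynomial.homogeneousSubmodule_fg σ ℚ d).map _)

lemma homogeneousSubmodule_succ (d : ℕ) :
    MvPolynomial.homogeneousSubmodule σ ℚ (d + 1) =
      Submodule.span ℚ (Set.range MvPolynomial.X) * MvPolynomial.homogeneousSubmodule σ ℚ d := by
  rw [← MvPolynomial.homogeneousSubmodule_one_pow, pow_succ',
    MvPolynomial.homogeneousSubmodule_one_pow, MvPolynomial.homogeneousSubmodule_one_eq_span_X]

/-- A family of subspaces that contains `1` and is stable under multiplication by the variables
contains the homogeneous polynomials. -/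
lemma homogeneousSubmodule_le_of_X_mul_mem (W : ℕ → Submodule ℚ (MvPolynomial σ ℚ))
    (h1 : 1 ∈ W 0) (hX : ∀ d s, ∀ f ∈ W d, MvPolynomial.X s * f ∈ W (d + 1)) (d : ℕ) :
    MvPolynomial.homogeneousSubmodule σ ℚ d ≤ W d := by
  induction d with
  | zero =>
    rw [MvPolynomial.homogeneousSubmodule_zero, Submodule.one_le]
    exact h1
  | succ d ih =>
    rw [homogeneousSubmodule_succ, Submodule.mul_le]
    intro l hl f hf
    induction hl using Submodule.span_induction with
    | mem l hl =>
      obtain ⟨s, rfl⟩ := hl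
      exact hX d s f (ih hf)
    | zero => simp
    | add l l' _ _ h h' => rw [add_mul]; exact add_mem h h'
    | smul c l _ h => rw [smul_mul_assoc]; exact Submodule.smul_mem _ _ h

lemma isHomogeneous_map {τ : Type*} (f : MvPolynomial σ ℚ →ₐ[ℚ] MvPolynomial τ ℚ)
    (hf : ∀ s, (f (MvPolynomial.X s)).IsHomogeneous 1) {d : ℕ} {p : MvPolynomial σ ℚ}
    (hp : p.IsHomogeneous d) : (f p).IsHomogeneous d := by
  rw [MvPolynomial.aeval_unique f]
  simpa [Function.comp_def] using hp.aeval _ hf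

/-- Modulo I the map g is a left inverse of f, so f induces an injection of quotients, and it
preserves degrees. -/
lemma finrank_le_of_graded_maps {τ : Type*} {I : Ideal (MvPolynomial σ ℚ)}
    {J : Ideal (MvPolynomial τ ℚ)} [Finite σ] [Finite τ]
    (f : MvPolynomial σ ℚ →ₐ[ℚ] MvPolynomial τ ℚ) (hf : ∀ s, (f (MvPolynomial.X s)).IsHomogeneous 1)
    (hI : I ≤ J.comap f)
    (g : MvPolynomial τ ℚ →ₐ[ℚ] MvPolynomial σ ℚ)
    (hgf : ∀ s, g (f (MvPolynomial.X s)) - MvPolynomial.X s ∈ I) (hJ : J ≤ I.comap g) (d : ℕ) :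
    Module.finrank ℚ (quotientPiece I d) ≤ Module.finrank ℚ (quotientPiece J d) := by
  have hgf' : ∀ p, g (f p) - p ∈ I := by
    intro p
    rw [← Ideal.Quotient.eq]
    have : (Ideal.Quotient.mkₐ ℚ I).comp (g.comp f) = Ideal.Quotient.mkₐ ℚ I := by
      ext s
      exact (Ideal.Quotient.eq).2 (hgf s)
    exact DFunLike.congr_fun this p
  let F : (MvPolynomial σ ℚ ⧸ I) →ₗ[ℚ] (MvPolynomial τ ℚ ⧸ J) :=
    (Ideal.quotientMapₐ J f hI).toLinearMap
  have hF : ∀ p, F (Ideal.Quotient.mk I p) = Ideal.Quotient.mk J (f p) := fun p => rfl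
  have hFinj : Function.Injective F := by
    rw [← LinearMap.ker_eq_bot, LinearMap.ker_eq_bot']
    intro y hy
    obtain ⟨p, rfl⟩ := Ideal.Quotient.mk_surjective y
    rw [hF, Ideal.Quotient.eq_zero_iff_mem] at hy
    rw [Ideal.Quotient.eq_zero_iff_mem]
    have := sub_mem (Ideal.mem_comap.1 (hJ hy)) (hgf' p)
    rwa [sub_sub_cancel] at this
  have hmap : (quotientPiece I d).map F ≤ quotientPiece J d := by
    rintro _ ⟨_, ⟨p, hp, rfl⟩, rfl⟩
    exact mem_quotientPiece.2 ⟨f p, isHomogeneous_map f hf hp, rfl⟩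
  rw [(Submodule.equivMapOfInjective F hFinj _).finrank_eq]
  exact Submodule.finrank_mono hmap

lemma hilbertSeries_eq_of_graded_maps {τ : Type*} {I : Ideal (MvPolynomial σ ℚ)}
    {J : Ideal (MvPolynomial τ ℚ)} [Finite σ] [Finite τ]
    (f : MvPolynomial σ ℚ →ₐ[ℚ] MvPolynomial τ ℚ) (hf : ∀ s, (f (MvPolynomial.X s)).IsHomogeneous 1)
    (hI : I ≤ J.comap f)
    (g : MvPolynomial τ ℚ →ₐ[ℚ] MvPolynomial σ ℚ) (hg : ∀ s, (g (MvPolynomial.X s)).IsHomogeneous 1)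
    (hJ : J ≤ I.comap g)
    (hgf : ∀ s, g (f (MvPolynomial.X s)) - MvPolynomial.X s ∈ I)
    (hfg : ∀ s, f (g (MvPolynomial.X s)) - MvPolynomial.X s ∈ J) :
    hilbertSeries I = hilbertSeries J := by
  ext d
  rw [hilbertSeries, hilbertSeries, PowerSeries.coeff_mk, PowerSeries.coeff_mk,
    le_antisymm (finrank_le_of_graded_maps f hf hI g hgf hJ d)
      (finrank_le_of_graded_maps g hg hJ f hfg hI d)]

end GradedPieces

/-! ### Substitutions for one variable -/

section Substitution

variable {P : Type*} {B : Type*} [CommRing B] [Algebra ℚ B]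

/-- The substitution that sets the variable of `Z` to zero. -/
noncomputable def killVar (Z : P) : MvPolynomial P ℚ →ₐ[ℚ] MvPolynomial P ℚ :=
  open scoped Classical in
  MvPolynomial.aeval fun F => if F = Z then 0 else MvPolynomial.X F

lemma killVar_X_self (Z : P) : killVar Z (MvPolynomial.X Z) = 0 := by
  simp [killVar]

lemma killVar_X_of_ne {F Z : P} (h : F ≠ Z) :
    killVar Z (MvPolynomial.X F) = MvPolynomial.X F := by
  simp [killVar, h]

lemma isHomogeneous_killVar (Z : P) {d : ℕ} {f : MvPolynomial P ℚ} (hf : f.IsHomogeneous d) :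
    (killVar Z f).IsHomogeneous d := by
  refine isHomogeneous_map (killVar Z) (fun F => ?_) hf
  by_cases h : F = Z
  · rw [h, killVar_X_self]
    exact MvPolynomial.isHomogeneous_zero _ _ _
  · rw [killVar_X_of_ne h]
    exact MvPolynomial.isHomogeneous_X _ _

/-- The substitution of a polynomial variable for the variable of `Z`, over an algebra `B`. -/
noncomputable def splitVar (π : MvPolynomial P ℚ →ₐ[ℚ] B) (Z : P) :
    MvPolynomial P ℚ →ₐ[ℚ] B[X] :=
  open scoped Classical in
  MvPolynomial.aeval fun F => C (π (MvPolynomial.X F)) + if F = Z then X else 0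

lemma splitVar_X_of_ne (π : MvPolynomial P ℚ →ₐ[ℚ] B) {F Z : P} (h : F ≠ Z) :
    splitVar π Z (MvPolynomial.X F) = C (π (MvPolynomial.X F)) := by
  simp [splitVar, h]

lemma splitVar_X_self {π : MvPolynomial P ℚ →ₐ[ℚ] B} {Z : P} (h : π (MvPolynomial.X Z) = 0) :
    splitVar π Z (MvPolynomial.X Z) = X := by
  simp [splitVar, h]

lemma splitVar_killVar {π : MvPolynomial P ℚ →ₐ[ℚ] B} {Z : P} (h : π (MvPolynomial.X Z) = 0)
    (f : MvPolynomial P ℚ) : splitVar π Z (killVar Z f) = C (π f) := by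
  have : (splitVar π Z).comp (killVar Z) = (CAlgHom (R := ℚ) (A := B)).comp π := by
    refine MvPolynomial.algHom_ext fun F => ?_
    by_cases hF : F = Z
    · subst hF
      simp [killVar_X_self, h]
    · simp [killVar_X_of_ne hF, splitVar_X_of_ne π hF]
  exact DFunLike.congr_fun this f

end Substitution

/-! ### The ideals of Chow rings relative to an upper set -/

section ChainIdeal

variable {P : Type*} [SemilatticeSup P] [Fintype P]

/-- The ideal of relations for the Chow ring supported on the upper set `U`, with the rank function
shifted by `c`. -/
noncomputable def chainIdeal (rk : P → ℕ) (U : Set P) (c : ℕ) : Ideal (MvPolynomial P ℚ) :=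
  Ideal.span
    ({f | ∃ F, F ∉ U ∧ f = MvPolynomial.X F} ∪
     {f | ∃ F G, ¬ F ≤ G ∧ ¬ G ≤ F ∧ f = MvPolynomial.X F * MvPolynomial.X G} ∪
     {f | ∃ F G m, F < G ∧ rk G ≤ rk F + m ∧
        f = MvPolynomial.X F * upperSum MvPolynomial.X G ^ m} ∪
     {f | ∃ G m, G ∈ U ∧ rk G ≤ c + m ∧ f = upperSum MvPolynomial.X G ^ m})

lemma chainIdeal_le_iff {rk : P → ℕ} {U : Set P} {c : ℕ} {J : Ideal (MvPolynomial P ℚ)} :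
    chainIdeal rk U c ≤ J ↔
      (∀ F, F ∉ U → MvPolynomial.X F ∈ J) ∧
      (∀ F G, ¬ F ≤ G → ¬ G ≤ F → MvPolynomial.X F * MvPolynomial.X G ∈ J) ∧
      (∀ F G m, F < G → rk G ≤ rk F + m →
        MvPolynomial.X F * upperSum MvPolynomial.X G ^ m ∈ J) ∧
      (∀ G m, G ∈ U → rk G ≤ c + m → upperSum MvPolynomial.X G ^ m ∈ J) := by
  rw [chainIdeal, Ideal.span_le]
  simp only [Set.union_subset_iff, and_assoc]
  refine and_congr ?_ (and_congr ?_ (and_congr ?_ ?_))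
  · exact ⟨fun h F hF => h ⟨F, hF, rfl⟩, by rintro h _ ⟨F, hF, rfl⟩; exact h F hF⟩
  · exact ⟨fun h F G h1 h2 => h ⟨F, G, h1, h2, rfl⟩,
      by rintro h _ ⟨F, G, h1, h2, rfl⟩; exact h F G h1 h2⟩
  · exact ⟨fun h F G m h1 h2 => h ⟨F, G, m, h1, h2, rfl⟩,
      by rintro h _ ⟨F, G, m, h1, h2, rfl⟩; exact h F G m h1 h2⟩
  · exact ⟨fun h G m h1 h2 => h ⟨G, m, h1, h2, rfl⟩,
      by rintro h _ ⟨G, m, h1, h2, rfl⟩; exact h G m h1 h2⟩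

lemma X_mem_chainIdeal (rk : P → ℕ) {U : Set P} (c : ℕ) {F : P} (h : F ∉ U) :
    MvPolynomial.X F ∈ chainIdeal rk U c :=
  (chainIdeal_le_iff.1 le_rfl).1 F h

lemma X_mul_X_mem_chainIdeal (rk : P → ℕ) (U : Set P) (c : ℕ) {F G : P} (h : ¬ F ≤ G)
    (h' : ¬ G ≤ F) : MvPolynomial.X F * MvPolynomial.X G ∈ chainIdeal rk U c :=
  (chainIdeal_le_iff.1 le_rfl).2.1 F G h h'

lemma X_mul_upperSum_pow_mem_chainIdeal {rk : P → ℕ} (U : Set P) (c : ℕ) {F G : P} {m : ℕ}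
    (h : F < G) (hm : rk G ≤ rk F + m) :
    MvPolynomial.X F * upperSum MvPolynomial.X G ^ m ∈ chainIdeal rk U c :=
  (chainIdeal_le_iff.1 le_rfl).2.2.1 F G m h hm

lemma upperSum_pow_mem_chainIdeal {rk : P → ℕ} {U : Set P} {c : ℕ} {G : P} {m : ℕ}
    (h : G ∈ U) (hm : rk G ≤ c + m) :
    upperSum MvPolynomial.X G ^ m ∈ chainIdeal rk U c :=
  (chainIdeal_le_iff.1 le_rfl).2.2.2 G m h hm

lemma chainRelations_quotient (rk : P → ℕ) (U : Set P) (c : ℕ) :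
    ChainRelations rk fun F => Ideal.Quotient.mk (chainIdeal rk U c) (MvPolynomial.X F) where
  incomparable F G h h' := by
    rw [← map_mul, Ideal.Quotient.eq_zero_iff_mem]
    exact X_mul_X_mem_chainIdeal rk U c h h'
  lt F G m h hm := by
    rw [← map_upperSum, ← map_pow, ← map_mul, Ideal.Quotient.eq_zero_iff_mem]
    exact X_mul_upperSum_pow_mem_chainIdeal U c h hm

/-- The data of a minimal element `Z` adjoined to an upper set `U`. -/
structure IsExtension (rk : P → ℕ) (U : Set P) (c : ℕ) (Z : P) : Prop where
  submodular : SubmodularAbove rk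
  isUpperSet : IsUpperSet U
  notMem : Z ∉ U
  Ioi_subset : Set.Ioi Z ⊆ U
  lt_rank : c < rk Z
  rank_sup : ∀ F ∈ U, rk (F ⊔ Z) + c ≤ rk F + rk Z

namespace IsExtension

variable {rk : P → ℕ} {U : Set P} {c : ℕ} {Z : P} (h : IsExtension rk U c Z)
include h

/-- This provides the hypothesis J h^r = 0 of `eq_zero_of_mem_span_sup`. For F ∈ U not above Z, x_F
h_Z^r = x_F h_{F ⊔ Z}^r = 0 by `rank_sup`; for G > Z, h_Z^r h_G^m = h_G^(r + m), which is a relation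
for U. -/
lemma mul_upperSum_pow_mem {k : MvPolynomial P ℚ} (hk : k ∈ chainIdeal rk (Set.Ioi Z) (rk Z)) :
    k * upperSum MvPolynomial.X Z ^ (rk Z - c) ∈ chainIdeal rk U c := by
  have hr := h.lt_rank
  have hrel := chainRelations_quotient rk U c
  suffices chainIdeal rk (Set.Ioi Z) (rk Z) ≤ Submodule.comap
      (LinearMap.mulLeft (MvPolynomial P ℚ) (upperSum MvPolynomial.X Z ^ (rk Z - c)))
      (chainIdeal rk U c) by
    have := this hk
    rwa [Submodule.mem_comap, LinearMap.mulLeft_apply, mul_comm] at this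
  rw [chainIdeal_le_iff]
  simp only [Submodule.mem_comap, LinearMap.mulLeft_apply]
  refine ⟨fun F hF => ?_, fun F G h1 h2 => ?_, fun F G m h1 h2 => ?_, fun G m h1 h2 => ?_⟩
  · by_cases hFU : F ∈ U
    · have hZF : ¬ Z ≤ F := fun h3 =>
        hF (lt_of_le_of_ne h3 fun h4 => h.notMem (h4 ▸ hFU))
      have := h.rank_sup F hFU
      have := hrel.mul_upperSum_pow hZF (m := rk Z - c) (by omega)
      rw [← map_upperSum, ← map_pow, ← map_mul, Ideal.Quotient.eq_zero_iff_mem] at this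
      rwa [mul_comm]
    · exact Ideal.mul_mem_left _ _ (X_mem_chainIdeal rk c hFU)
  · exact Ideal.mul_mem_left _ _ (X_mul_X_mem_chainIdeal rk U c h1 h2)
  · exact Ideal.mul_mem_left _ _ (X_mul_upperSum_pow_mem_chainIdeal U c h1 h2)
  · have hZG : Z < G := h1
    have := hrel.upperSum_pow_mul_upperSum_pow h.submodular hZG.le h2 (rk Z - c)
    rw [← map_upperSum, ← map_upperSum, ← map_pow, ← map_pow, ← map_pow, ← map_mul,
      Ideal.Quotient.eq] at this
    have h3 : upperSum MvPolynomial.X G ^ (rk Z - c + m) ∈ chainIdeal rk U c :=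
      upperSum_pow_mem_chainIdeal (h.Ioi_subset h1) (by omega)
    simpa using add_mem this h3

/-- Once the variables not above Z are killed, h_G becomes h_{G ⊔ Z}. So the ring above Z is a
quotient of the ring of U. -/
lemma chainIdeal_le : chainIdeal rk U c ≤ chainIdeal rk (Set.Ioi Z) (rk Z) := by
  classical
  have hr := h.lt_rank
  rw [chainIdeal_le_iff]
  refine ⟨fun F hF => X_mem_chainIdeal _ _ fun h1 => hF (h.Ioi_subset h1),
    fun F G h1 h2 => X_mul_X_mem_chainIdeal _ _ _ h1 h2,
    fun F G m h1 h2 => X_mul_upperSum_pow_mem_chainIdeal _ _ h1 h2, fun G m h1 h2 => ?_⟩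
  have hGZ : ¬ G ≤ Z := fun h3 => h.notMem (h.isUpperSet h3 h1)
  have hlt : Z < G ⊔ Z := right_lt_sup.2 hGZ
  have h3 := h.rank_sup G h1
  have h4 : upperSum MvPolynomial.X (G ⊔ Z) ^ m ∈ chainIdeal rk (Set.Ioi Z) (rk Z) :=
    upperSum_pow_mem_chainIdeal hlt (by omega)
  rw [← Ideal.Quotient.eq_zero_iff_mem, map_pow] at h4 ⊢
  rw [← h4]
  congr 1
  rw [Ideal.Quotient.eq, upperSum_sub_upperSum _ le_sup_left]
  refine sum_mem fun H hH => X_mem_chainIdeal _ _ fun h5 => ?_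
  obtain ⟨h6, h7⟩ := (Finset.mem_filter.1 hH).2
  exact h7 (sup_le h6 (le_of_lt h5))

end IsExtension

lemma killVar_upperSum {G Z : P} (h : ¬ G ≤ Z) :
    killVar Z (upperSum MvPolynomial.X G) = upperSum MvPolynomial.X G := by
  classical
  rw [upperSum, map_sum]
  refine Finset.sum_congr rfl fun H hH => killVar_X_of_ne ?_
  rintro rfl
  exact h (Finset.mem_filter.1 hH).2

lemma upperSum_self_eq (Z : P) : (upperSum MvPolynomial.X Z : MvPolynomial P ℚ) =
    MvPolynomial.X Z + killVar Z (upperSum MvPolynomial.X Z) := by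
  classical
  rw [upperSum, map_sum, show ({H : P | Z ≤ H} : Finset P) = insert Z ({H : P | Z < H} : Finset P) by
    ext H; simp [le_iff_eq_or_lt, eq_comm], Finset.sum_insert (by simp),
    Finset.sum_insert (by simp), killVar_X_self, zero_add]
  congr 1
  exact Finset.sum_congr rfl fun H hH => (killVar_X_of_ne (Finset.mem_filter.1 hH).2.ne').symm

open scoped Classical in
lemma splitVar_upperSum {B : Type*} [CommRing B] [Algebra ℚ B] (π : MvPolynomial P ℚ →ₐ[ℚ] B)
    (G Z : P) : splitVar π Z (upperSum MvPolynomial.X G) =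
      C (π (upperSum MvPolynomial.X G)) + if G ≤ Z then X else 0 := by
  rw [upperSum, map_sum, map_sum, map_sum]
  simp only [splitVar, MvPolynomial.aeval_X]
  rw [Finset.sum_add_distrib, Finset.sum_ite_eq']
  simp

namespace IsExtension

variable {rk : P → ℕ} {U : Set P} {c : ℕ} {Z : P} (h : IsExtension rk U c Z)
include h

omit [Fintype P] in
lemma notMem_insert {F : P} (hF : F < Z) : F ∉ insert Z U := by
  rintro (rfl | hFU)
  · exact hF.false
  · exact h.notMem (h.isUpperSet hF.le hFU)

/-- The target models the ring of `insert Z U` as B[X] modulo (X + h)^r and X·K. Relations with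
factor x_Z fall into X·K, powers of h_Z become powers of X + h, and the remaining generators come
from relations of U. -/
lemma splitVar_mem {B : Type*} [CommRing B] [Algebra ℚ B] (π : MvPolynomial P ℚ →ₐ[ℚ] B)
    (hπ : ∀ f ∈ chainIdeal rk U c, π f = 0) {f : MvPolynomial P ℚ}
    (hf : f ∈ chainIdeal rk (insert Z U) c) :
    splitVar π Z f ∈ Ideal.span {(X + C (π (upperSum MvPolynomial.X Z))) ^ (rk Z - c)} ⊔
      Ideal.span {X} * ((chainIdeal rk (Set.Ioi Z) (rk Z)).map π).map C := by
  set K := chainIdeal rk (Set.Ioi Z) (rk Z)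
  set T : Ideal B[X] := Ideal.span {(X + C (π (upperSum MvPolynomial.X Z))) ^ (rk Z - c)} ⊔
    Ideal.span {X} * (K.map π).map C
  have hXZ : π (MvPolynomial.X Z) = 0 := hπ _ (X_mem_chainIdeal rk c h.notMem)
  have hK : ∀ k ∈ K, X * C (π k) ∈ T := fun k hk =>
    Ideal.mem_sup_right (Ideal.mul_mem_mul (Ideal.mem_span_singleton_self X)
      (Ideal.mem_map_of_mem _ (Ideal.mem_map_of_mem _ hk)))
  have hI : ∀ f ∈ chainIdeal rk U c, C (π f) ∈ T := fun f hf => by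
    rw [hπ f hf, C_0]
    exact zero_mem _
  have hsum : ∀ G, ¬ G ≤ Z → splitVar π Z (upperSum MvPolynomial.X G) =
      C (π (upperSum MvPolynomial.X G)) := fun G hG => by
    rw [splitVar_upperSum, if_neg hG, add_zero]
  suffices chainIdeal rk (insert Z U) c ≤ T.comap (splitVar π Z) from this hf
  rw [chainIdeal_le_iff]
  simp only [Ideal.mem_comap, map_mul, map_pow]
  refine ⟨fun F hF => ?_, fun F G h1 h2 => ?_, fun F G m h1 h2 => ?_, fun G m h1 h2 => ?_⟩
  · rw [Set.mem_insert_iff, not_or] at hF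
    rw [splitVar_X_of_ne π hF.1]
    exact hI _ (X_mem_chainIdeal rk c hF.2)
  · by_cases hF : F = Z
    · subst hF
      rw [splitVar_X_self hXZ, splitVar_X_of_ne π fun h3 => h1 h3.ge]
      exact hK _ (X_mem_chainIdeal _ _ fun h3 => h1 (le_of_lt h3))
    · by_cases hG : G = Z
      · subst hG
        rw [splitVar_X_self hXZ, splitVar_X_of_ne π hF, mul_comm]
        exact hK _ (X_mem_chainIdeal _ _ fun h3 => h2 (le_of_lt h3))
      · rw [splitVar_X_of_ne π hF, splitVar_X_of_ne π hG, ← C_mul, ← map_mul]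
        exact hI _ (X_mul_X_mem_chainIdeal _ _ _ h1 h2)
  · by_cases hF : F = Z
    · subst hF
      rw [splitVar_X_self hXZ, hsum G h1.not_ge, ← C_pow, ← map_pow]
      exact hK _ (upperSum_pow_mem_chainIdeal h1 h2)
    · rw [splitVar_X_of_ne π hF]
      by_cases hG : G ≤ Z
      · have h3 : F ∉ U := fun h3 => h.notMem_insert (h1.trans_le hG) (Or.inr h3)
        exact Ideal.mul_mem_right _ _ (hI _ (X_mem_chainIdeal _ _ h3))
      · rw [hsum G hG, ← C_pow, ← C_mul, ← map_pow, ← map_mul]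
        exact hI _ (X_mul_upperSum_pow_mem_chainIdeal _ _ h1 h2)
  · rcases h1 with rfl | h1
    · rw [splitVar_upperSum, if_pos le_rfl, add_comm]
      refine Ideal.mem_sup_left (Ideal.mem_span_singleton.2 (pow_dvd_pow _ ?_))
      omega
    · rw [hsum G fun h3 => h.notMem (h.isUpperSet h3 h1), ← C_pow, ← map_pow]
      exact hI _ (upperSum_pow_mem_chainIdeal h1 h2)

lemma killVar_X_mul_upperSum_pow_mem {F G : P} {m : ℕ} (h1 : F < G) (h2 : rk G ≤ rk F + m) :
    killVar Z (MvPolynomial.X F * upperSum MvPolynomial.X G ^ m) ∈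
      chainIdeal rk (insert Z U) c := by
  rw [map_mul, map_pow]
  by_cases hF : F = Z
  · rw [hF, killVar_X_self, zero_mul]
    exact zero_mem _
  rw [killVar_X_of_ne hF]
  by_cases hG : G ≤ Z
  · exact Ideal.mul_mem_right _ _ (X_mem_chainIdeal _ _ (h.notMem_insert (h1.trans_le hG)))
  · rw [killVar_upperSum hG]
    exact X_mul_upperSum_pow_mem_chainIdeal _ _ h1 h2

omit h in
lemma killVar_X_mul_X_mem {F G : P} (h1 : ¬ F ≤ G) (h2 : ¬ G ≤ F) :
    killVar Z (MvPolynomial.X F * MvPolynomial.X G) ∈ chainIdeal rk (insert Z U) c := by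
  rw [map_mul]
  by_cases hF : F = Z
  · rw [hF, killVar_X_self, zero_mul]
    exact zero_mem _
  by_cases hG : G = Z
  · rw [hG, killVar_X_self, mul_zero]
    exact zero_mem _
  rw [killVar_X_of_ne hF, killVar_X_of_ne hG]
  exact X_mul_X_mem_chainIdeal _ _ _ h1 h2

lemma killVar_mem {f : MvPolynomial P ℚ} (hf : f ∈ chainIdeal rk U c) :
    killVar Z f ∈ chainIdeal rk (insert Z U) c := by
  suffices chainIdeal rk U c ≤ (chainIdeal rk (insert Z U) c).comap (killVar Z) from this hf
  rw [chainIdeal_le_iff]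
  refine ⟨fun F hF => ?_, fun F G h1 h2 => killVar_X_mul_X_mem h1 h2,
    fun F G m h1 h2 => h.killVar_X_mul_upperSum_pow_mem h1 h2, fun G m h1 h2 => ?_⟩
  · rw [Ideal.mem_comap]
    by_cases hFZ : F = Z
    · rw [hFZ, killVar_X_self]
      exact zero_mem _
    · rw [killVar_X_of_ne hFZ]
      exact X_mem_chainIdeal _ _ (by simp [hFZ, hF])
  · rw [Ideal.mem_comap, map_pow, killVar_upperSum fun h3 => h.notMem (h.isUpperSet h3 h1)]
    exact upperSum_pow_mem_chainIdeal (Or.inr h1) h2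

/-- This makes multiplication by x_Z well defined on the ring above Z: x_Z h_G^m is a relation
exactly in the range where h_G^m is one above Z. -/
lemma X_mul_killVar_mem {f : MvPolynomial P ℚ} (hf : f ∈ chainIdeal rk (Set.Ioi Z) (rk Z)) :
    MvPolynomial.X Z * killVar Z f ∈ chainIdeal rk (insert Z U) c := by
  suffices chainIdeal rk (Set.Ioi Z) (rk Z) ≤ Ideal.comap (killVar Z) (Submodule.comap
      (LinearMap.mulLeft (MvPolynomial P ℚ) (MvPolynomial.X Z)) (chainIdeal rk (insert Z U) c))
    from this hf
  rw [chainIdeal_le_iff]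
  simp only [Ideal.mem_comap, Submodule.mem_comap, LinearMap.mulLeft_apply]
  refine ⟨fun F hF => ?_, fun F G h1 h2 => Ideal.mul_mem_left _ _ (killVar_X_mul_X_mem h1 h2),
    fun F G m h1 h2 => Ideal.mul_mem_left _ _ (h.killVar_X_mul_upperSum_pow_mem h1 h2),
    fun G m h1 h2 => ?_⟩
  · by_cases hFZ : F = Z
    · rw [hFZ, killVar_X_self, mul_zero]
      exact zero_mem _
    · rw [killVar_X_of_ne hFZ]
      have hZF : ¬ Z ≤ F := fun h3 => hF (lt_of_le_of_ne h3 (Ne.symm hFZ))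
      by_cases hlt : F ≤ Z
      · exact Ideal.mul_mem_left _ _
          (X_mem_chainIdeal _ _ (h.notMem_insert (lt_of_le_of_ne hlt hFZ)))
      · exact X_mul_X_mem_chainIdeal _ _ _ hZF hlt
  · rw [map_pow, killVar_upperSum (not_le_of_gt h1)]
    exact X_mul_upperSum_pow_mem_chainIdeal _ _ h1 h2

end IsExtension

end ChainIdeal

/-! ### Direct sum decomposition of the ring and recursion for its Hilbert series. -/

section HilbertRecursion

variable {P : Type*} [SemilatticeSup P] [Fintype P]

namespace IsExtension

variable {rk : P → ℕ} {U : Set P} {c : ℕ} {Z : P} (h : IsExtension rk U c Z)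
include h

/-- The map from the Chow ring supported on `U` to the one supported on `insert Z U`. -/
noncomputable def constMap : (MvPolynomial P ℚ ⧸ chainIdeal rk U c) →ₗ[ℚ]
    MvPolynomial P ℚ ⧸ chainIdeal rk (insert Z U) c :=
  (Ideal.quotientMapₐ (chainIdeal rk (insert Z U) c) (killVar Z) fun _ hf =>
    Ideal.mem_comap.2 (h.killVar_mem hf)).toLinearMap

lemma constMap_mk (f : MvPolynomial P ℚ) :
    h.constMap (Ideal.Quotient.mk _ f) = Ideal.Quotient.mk _ (killVar Z f) := rfl

/-- The multiplication by a positive power of the variable of `Z`, as a map from the Chow ring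
supported above `Z` to the one supported on `insert Z U`. -/
noncomputable def powMap (i : ℕ) : (MvPolynomial P ℚ ⧸ chainIdeal rk (Set.Ioi Z) (rk Z)) →ₗ[ℚ]
    MvPolynomial P ℚ ⧸ chainIdeal rk (insert Z U) c :=
  -- The map is not multiplicative, so it is built on additive groups; additive maps of rational
  -- vector spaces are linear.
  AddMonoidHom.toRatLinearMap (M := MvPolynomial P ℚ ⧸ chainIdeal rk (Set.Ioi Z) (rk Z)) <|
  QuotientAddGroup.lift (chainIdeal rk (Set.Ioi Z) (rk Z)).toAddSubgroup
    ((Ideal.Quotient.mk (chainIdeal rk (insert Z U) c)).toAddMonoidHom.comp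
      ((AddMonoidHom.mulLeft (MvPolynomial.X Z ^ (i + 1))).comp
        (killVar Z).toRingHom.toAddMonoidHom)) fun f hf => by
      refine Ideal.Quotient.eq_zero_iff_mem.2 ?_
      change MvPolynomial.X Z ^ (i + 1) * killVar Z f ∈ _
      rw [pow_succ, mul_assoc]
      exact Ideal.mul_mem_left _ _ (h.X_mul_killVar_mem hf)

lemma powMap_mk (i : ℕ) (f : MvPolynomial P ℚ) :
    h.powMap i (Ideal.Quotient.mk _ f) =
      Ideal.Quotient.mk _ (MvPolynomial.X Z ^ (i + 1) * killVar Z f) := rfl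

/-- Apply `splitVar` with B = A_U. The criterion gives a = 0 and puts each b_i into the image of the
ideal above Z, that is, makes it zero in A_{>Z}. -/
lemma constMap_add_sum_powMap_injective {n : ℕ} (hn : n < rk Z - c)
    (a : MvPolynomial P ℚ ⧸ chainIdeal rk U c)
    (b : Fin n → MvPolynomial P ℚ ⧸ chainIdeal rk (Set.Ioi Z) (rk Z))
    (hab : h.constMap a + ∑ i, h.powMap i.1 (b i) = 0) : a = 0 ∧ b = 0 := by
  obtain ⟨f, rfl⟩ := Ideal.Quotient.mk_surjective a
  choose g hg using fun i => Ideal.Quotient.mk_surjective (b i)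
  obtain rfl : (fun i => Ideal.Quotient.mk _ (g i)) = b := funext hg
  simp only [constMap_mk, powMap_mk, ← map_sum, ← map_add] at hab
  rw [Ideal.Quotient.eq_zero_iff_mem] at hab
  have hπ : ∀ f ∈ chainIdeal rk U c, Ideal.Quotient.mkₐ ℚ (chainIdeal rk U c) f = 0 :=
    fun f hf => Ideal.Quotient.eq_zero_iff_mem.2 hf
  have hXZ := hπ _ (X_mem_chainIdeal rk c h.notMem)
  have hmem := h.splitVar_mem (Ideal.Quotient.mkₐ ℚ (chainIdeal rk U c)) hπ hab
  simp only [map_add, map_sum, map_mul, map_pow, splitVar_killVar hXZ, splitVar_X_self hXZ] at hmem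
  have key := eq_zero_of_mem_span_sup hn ?_ _ _ hmem
  · refine ⟨key.1, funext fun i => ?_⟩
    have := key.2 i
    rw [← Ideal.mem_comap, Ideal.comap_map_of_surjective _ (Ideal.Quotient.mkₐ_surjective ℚ _)]
      at this
    obtain ⟨k, hk, k', hk', hkk⟩ := Submodule.mem_sup.1 this
    refine Ideal.Quotient.eq_zero_iff_mem.2 (hkk ▸ add_mem hk (h.chainIdeal_le ?_))
    exact Ideal.Quotient.eq_zero_iff_mem.1 (Ideal.mem_bot.1 (Ideal.mem_comap.1 hk'))
  · intro y hy
    obtain ⟨k, hk, rfl⟩ := (Ideal.mem_map_iff_of_surjective _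
      (Ideal.Quotient.mkₐ_surjective ℚ _)).1 hy
    rw [← map_pow, ← map_mul]
    exact hπ _ (h.mul_upperSum_pow_mem hk)

/-- The span of the products of a power of the variable of `Z` with exponent less than its
nilpotency degree and a polynomial in the other variables, modulo the relations. -/
noncomputable def normalForms (_ : IsExtension rk U c Z) (d : ℕ) :
    Submodule ℚ (MvPolynomial P ℚ) :=
  Submodule.span ℚ {f | ∃ k g, k < rk Z - c ∧ k ≤ d ∧
    MvPolynomial.IsHomogeneous g (d - k) ∧ f = MvPolynomial.X Z ^ k * killVar Z g} ⊔
  (chainIdeal rk (insert Z U) c).restrictScalars ℚ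

lemma X_pow_mul_killVar_mem_normalForms {d k : ℕ} (hk : k < rk Z - c) (hkd : k ≤ d)
    {g : MvPolynomial P ℚ} (hg : g.IsHomogeneous (d - k)) :
    MvPolynomial.X Z ^ k * killVar Z g ∈ h.normalForms d :=
  Submodule.mem_sup_left (Submodule.subset_span ⟨k, g, hk, hkd, hg, rfl⟩)

omit h in
lemma isHomogeneous_upperSum (G : P) :
    (upperSum MvPolynomial.X G : MvPolynomial P ℚ).IsHomogeneous 1 := by
  classical
  exact MvPolynomial.IsHomogeneous.sum _ _ _ fun F _ => MvPolynomial.isHomogeneous_X _ _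

/-- The relation h_Z^r = (x_Z + h)^r = 0, with h free of x_Z, is solved for x_Z^r by the binomial
theorem. -/
lemma X_pow_rank_mul_killVar_mem_normalForms {d : ℕ} (hd : rk Z - c ≤ d)
    {g : MvPolynomial P ℚ} (hg : g.IsHomogeneous (d - (rk Z - c))) :
    MvPolynomial.X Z ^ (rk Z - c) * killVar Z g ∈ h.normalForms d := by
  set r := rk Z - c with hr
  have h1 : upperSum MvPolynomial.X Z ^ r ∈ chainIdeal rk (insert Z U) c :=
    upperSum_pow_mem_chainIdeal (Set.mem_insert _ _) (by omega)
  have h2 : MvPolynomial.X Z ^ r * killVar Z g = upperSum MvPolynomial.X Z ^ r * killVar Z g -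
      ∑ k ∈ Finset.range r, (r.choose k : ℚ) • (MvPolynomial.X Z ^ k *
        killVar Z (upperSum MvPolynomial.X Z ^ (r - k) * g)) := by
    rw [eq_sub_iff_add_eq]
    conv_rhs => rw [upperSum_self_eq]
    rw [add_pow, Finset.sum_range_succ, Nat.sub_self, Nat.choose_self, pow_zero, Nat.cast_one,
      mul_one, mul_one, add_mul, Finset.sum_mul, add_comm]
    congr 1
    refine Finset.sum_congr rfl fun k _ => ?_
    rw [map_mul, map_pow, MvPolynomial.smul_eq_C_mul, map_natCast]
    ring
  rw [h2]
  refine sub_mem (Submodule.mem_sup_right (Ideal.mul_mem_right _ _ h1))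
    (sum_mem fun k hk => Submodule.smul_mem _ _ ?_)
  have hk := Finset.mem_range.1 hk
  refine h.X_pow_mul_killVar_mem_normalForms hk (by omega) ?_
  have := ((isHomogeneous_upperSum Z).pow (r - k)).mul hg
  rwa [show 1 * (r - k) + (d - r) = d - k by omega] at this

lemma homogeneousSubmodule_le_normalForms (d : ℕ) :
    MvPolynomial.homogeneousSubmodule P ℚ d ≤ h.normalForms d := by
  have hr := h.lt_rank
  refine homogeneousSubmodule_le_of_X_mul_mem h.normalForms ?_ ?_ d
  · have := h.X_pow_mul_killVar_mem_normalForms (d := 0) (k := 0) (by omega) le_rfl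
      (MvPolynomial.isHomogeneous_one P ℚ)
    simpa using this
  · intro d F f hf
    obtain ⟨f1, hf1, f2, hf2, rfl⟩ := Submodule.mem_sup.1 hf
    rw [mul_add]
    refine add_mem ?_ (Submodule.mem_sup_right (Ideal.mul_mem_left _ _ hf2))
    clear hf
    induction hf1 using Submodule.span_induction with
    | mem f hf =>
      obtain ⟨k, g, hk, hkd, hg, rfl⟩ := hf
      by_cases hF : F = Z
      · rw [hF, ← mul_assoc, ← pow_succ']
        rcases (Nat.succ_le_of_lt hk).eq_or_lt with hk' | hk'
        · rw [show k + 1 = rk Z - c from hk']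
          refine h.X_pow_rank_mul_killVar_mem_normalForms (by omega) ?_
          rwa [show d + 1 - (rk Z - c) = d - k by omega]
        · refine h.X_pow_mul_killVar_mem_normalForms hk' (by omega) ?_
          rwa [show d + 1 - (k + 1) = d - k by omega]
      · rw [mul_left_comm, ← killVar_X_of_ne hF, ← map_mul]
        refine h.X_pow_mul_killVar_mem_normalForms hk (by omega) ?_
        have := (MvPolynomial.isHomogeneous_X ℚ F).mul hg
        rwa [show 1 + (d - k) = d + 1 - k by omega] at this
    | zero => simp
    | add f g _ _ h1 h2 =>
      rw [mul_add]
      exact add_mem h1 h2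
    | smul a f _ h1 =>
      rw [mul_smul_comm]
      exact Submodule.smul_mem _ _ h1

/-- The decomposition of a graded piece of the Chow ring supported on `insert Z U`. -/
noncomputable def pieceMap (d : ℕ) :
    (quotientPiece (chainIdeal rk U c) d ×
      -- The exponents i + 1 run over 1, …, r − 1; the cut at d keeps d − (i + 1) an honest
      -- difference.
      ((i : Fin (min (rk Z - c - 1) d)) →
        quotientPiece (chainIdeal rk (Set.Ioi Z) (rk Z)) (d - (i.1 + 1)))) →ₗ[ℚ]
    MvPolynomial P ℚ ⧸ chainIdeal rk (insert Z U) c :=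
  (h.constMap ∘ₗ Submodule.subtype _).coprod
    (∑ i, (h.powMap i.1 ∘ₗ Submodule.subtype _) ∘ₗ LinearMap.proj i)

lemma pieceMap_apply (d : ℕ) (a : quotientPiece (chainIdeal rk U c) d)
    (b : (i : Fin (min (rk Z - c - 1) d)) →
        quotientPiece (chainIdeal rk (Set.Ioi Z) (rk Z)) (d - (i.1 + 1))) :
    h.pieceMap d (a, b) = h.constMap a.1 + ∑ i, h.powMap i.1 (b i).1 := by
  simp [pieceMap]

lemma pieceMap_injective (d : ℕ) : Function.Injective (h.pieceMap d) := by
  have hr := h.lt_rank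
  rw [← LinearMap.ker_eq_bot, LinearMap.ker_eq_bot']
  rintro ⟨a, b⟩ hab
  rw [pieceMap_apply] at hab
  obtain ⟨ha, hb⟩ := h.constMap_add_sum_powMap_injective (by omega) a.1 (fun i => (b i).1) hab
  refine Prod.ext (Subtype.ext ha) (funext fun i => Subtype.ext (congr_fun hb i))

lemma range_pieceMap (d : ℕ) :
    LinearMap.range (h.pieceMap d) = quotientPiece (chainIdeal rk (insert Z U) c) d := by
  have hr := h.lt_rank
  apply le_antisymm
  · rintro _ ⟨⟨⟨_, f, hf, rfl⟩, b⟩, rfl⟩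
    rw [pieceMap_apply]
    refine add_mem (mem_quotientPiece.2 ⟨_, isHomogeneous_killVar Z hf, rfl⟩)
      (sum_mem fun i _ => ?_)
    obtain ⟨g, hg, hgb⟩ := mem_quotientPiece.1 (b i).2
    rw [← hgb, powMap_mk]
    refine mem_quotientPiece.2 ⟨_, ?_, rfl⟩
    have := ((MvPolynomial.isHomogeneous_X ℚ Z).pow (i.1 + 1)).mul (isHomogeneous_killVar Z hg)
    rwa [show 1 * (i.1 + 1) + (d - (i.1 + 1)) = d by omega] at this
  · rintro _ ⟨f, hf, rfl⟩
    obtain ⟨f1, hf1, f2, hf2, rfl⟩ :=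
      Submodule.mem_sup.1 (h.homogeneousSubmodule_le_normalForms d hf)
    have hf2' : (Ideal.Quotient.mkₐ ℚ (chainIdeal rk (insert Z U) c)).toLinearMap f2 = 0 :=
      Ideal.Quotient.eq_zero_iff_mem.2 hf2
    rw [map_add, hf2', add_zero]
    clear hf hf2' hf2
    induction hf1 using Submodule.span_induction with
    | mem f hf =>
      obtain ⟨k, g, hk, hkd, hg, rfl⟩ := hf
      rcases k with _ | k
      · refine ⟨(⟨Ideal.Quotient.mk _ g, mem_quotientPiece.2 ⟨g, hg, rfl⟩⟩, 0), ?_⟩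
        rw [pieceMap_apply]
        simp [constMap_mk]
      · refine ⟨(0, Pi.single ⟨k, by omega⟩
          ⟨Ideal.Quotient.mk _ g, mem_quotientPiece.2 ⟨g, hg, rfl⟩⟩), ?_⟩
        rw [pieceMap_apply, Finset.sum_eq_single ⟨k, by omega⟩]
        · rw [Pi.single_eq_same, powMap_mk]
          simp
        · intro j _ hj
          rw [Pi.single_eq_of_ne hj]
          simp
        · simp
    | zero => simp
    | add f g _ _ h1 h2 =>
      rw [map_add]
      exact add_mem h1 h2
    | smul a f _ h1 =>
      rw [map_smul]
      exact Submodule.smul_mem _ _ h1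

lemma finrank_quotientPiece_insert (d : ℕ) :
    Module.finrank ℚ (quotientPiece (chainIdeal rk (insert Z U) c) d) =
      Module.finrank ℚ (quotientPiece (chainIdeal rk U c) d) +
      ∑ i ∈ Finset.range (min (rk Z - c - 1) d),
        Module.finrank ℚ (quotientPiece (chainIdeal rk (Set.Ioi Z) (rk Z)) (d - (i + 1))) := by
  rw [← h.range_pieceMap d, LinearMap.finrank_range_of_inj (h.pieceMap_injective d),
    Module.finrank_prod, Module.finrank_pi_fintype, Finset.sum_range]

lemma hilbertSeries_insert :
    hilbertSeries (chainIdeal rk (insert Z U) c) = hilbertSeries (chainIdeal rk U c) +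
      (truncGeom (rk Z - c - 1) : PowerSeries ℤ) *
        hilbertSeries (chainIdeal rk (Set.Ioi Z) (rk Z)) := by
  ext d
  have hgeom : (truncGeom (rk Z - c - 1) : PowerSeries ℤ) =
      ∑ i ∈ Finset.range (rk Z - c - 1), (PowerSeries.X : PowerSeries ℤ) ^ (i + 1) := by
    rw [truncGeom, ← Polynomial.coeToPowerSeries.ringHom_apply, map_sum]
    simp
  rw [map_add, hgeom, Finset.sum_mul, map_sum]
  simp only [PowerSeries.coeff_X_pow_mul']
  simp only [hilbertSeries, PowerSeries.coeff_mk]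
  rw [h.finrank_quotientPiece_insert, Nat.cast_add, Nat.cast_sum, ← Finset.sum_filter]
  congr 1
  refine Finset.sum_congr ?_ fun _ _ => rfl
  ext i
  simp only [Finset.mem_range, Finset.mem_filter]
  omega

end IsExtension

lemma hilbertSeries_chainIdeal_empty (rk : P → ℕ) (c : ℕ) :
    hilbertSeries (chainIdeal rk (∅ : Set P) c) = 1 := by
  have hX : ∀ F, MvPolynomial.X F ∈ chainIdeal rk (∅ : Set P) c := fun F =>
    X_mem_chainIdeal rk c (Set.notMem_empty F)
  ext d
  rw [hilbertSeries, PowerSeries.coeff_mk, PowerSeries.coeff_one]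
  rcases d with _ | d
  · have hle : chainIdeal rk (∅ : Set P) c ≤
        RingHom.ker (MvPolynomial.constantCoeff (σ := P) (R := ℚ)) := by
      rw [chainIdeal_le_iff]
      refine ⟨fun F _ => ?_, fun F G _ _ => ?_, fun F G m _ _ => ?_,
        fun G m h => absurd h (Set.notMem_empty G)⟩ <;> simp [RingHom.mem_ker]
    have h1 : (1 : MvPolynomial P ℚ ⧸ chainIdeal rk (∅ : Set P) c) ≠ 0 := by
      rw [← map_one (Ideal.Quotient.mk _), Ne, Ideal.Quotient.eq_zero_iff_mem]
      intro h
      have := hle h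
      simp [RingHom.mem_ker] at this
    rw [quotientPiece, MvPolynomial.homogeneousSubmodule_zero, Submodule.one_eq_span,
      Submodule.map_span, Set.image_singleton]
    rw [AlgHom.toLinearMap_apply, map_one, finrank_span_singleton h1]
    simp
  · have h0 : quotientPiece (chainIdeal rk (∅ : Set P) c) (d + 1) = ⊥ := by
      rw [eq_bot_iff]
      rintro _ ⟨f, hf, rfl⟩
      have hf' : f ∈ MvPolynomial.homogeneousSubmodule P ℚ (d + 1) := hf
      have : MvPolynomial.homogeneousSubmodule P ℚ (d + 1) ≤
          (chainIdeal rk (∅ : Set P) c).restrictScalars ℚ := by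
        rw [homogeneousSubmodule_succ, Submodule.mul_le]
        intro l hl f _
        induction hl using Submodule.span_induction with
        | mem l hl =>
          obtain ⟨s, rfl⟩ := hl
          exact Ideal.mul_mem_right _ _ (hX s)
        | zero => simp
        | add l l' _ _ h h' => rw [add_mul]; exact add_mem h h'
        | smul c l _ h => rw [smul_mul_assoc]; exact Submodule.smul_mem _ _ h
      exact Ideal.Quotient.eq_zero_iff_mem.2 (this hf')
    rw [h0]
    simp

open scoped Classical in
-- A minimal Z of U is removed at each step; its contribution involves only the ring above Z, not
-- the rest of U.
theorem hilbertSeries_chainIdeal {rk : P → ℕ} (hsub : SubmodularAbove rk)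
    (c : ℕ) (U : Finset P) (hU : IsUpperSet (U : Set P)) (hc : ∀ F ∈ U, c < rk F)
    (hs : ∀ F ∈ U, ∀ G ∈ U, rk (F ⊔ G) + c ≤ rk F + rk G) :
    hilbertSeries (chainIdeal rk (U : Set P) c) = 1 + ∑ Z ∈ U,
      (truncGeom (rk Z - c - 1) : PowerSeries ℤ) *
        hilbertSeries (chainIdeal rk (Set.Ioi Z) (rk Z)) := by
  induction U using Finset.strongInduction with
  | H U ih =>
    rcases U.eq_empty_or_nonempty with rfl | hne
    · simp [hilbertSeries_chainIdeal_empty]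
    obtain ⟨Z, hZ⟩ := U.exists_minimal hne
    have hcoe : (U : Set P) = insert Z ((U.erase Z : Finset P) : Set P) := by
      rw [← Finset.coe_insert, Finset.insert_erase hZ.1]
    have hup : IsUpperSet ((U.erase Z : Finset P) : Set P) := by
      intro F G hFG hF
      rw [Finset.mem_coe, Finset.mem_erase] at hF ⊢
      refine ⟨?_, hU hFG hF.2⟩
      rintro rfl
      exact hF.1 (le_antisymm hFG (hZ.2 hF.2 hFG))
    have hext : IsExtension rk ((U.erase Z : Finset P) : Set P) c Z := by
      refine ⟨hsub, hup, by simp, fun F hF => ?_, hc Z hZ.1, fun F hF => ?_⟩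
      · exact Finset.mem_erase.2 ⟨ne_of_gt hF, hU (le_of_lt hF) hZ.1⟩
      · exact hs F (Finset.mem_of_mem_erase hF) Z hZ.1
    rw [hcoe, hext.hilbertSeries_insert, ih _ (Finset.erase_ssubset hZ.1) hup
      (fun F hF => hc F (Finset.mem_of_mem_erase hF))
      (fun F hF G hG => hs F (Finset.mem_of_mem_erase hF) G (Finset.mem_of_mem_erase hG)),
      ← Finset.sum_erase_add _ _ hZ.1, add_assoc]

end HilbertRecursion

/-! ### The lattice of flats -/

section FlatsLattice

variable {α : Type*} {M : Matroid α}

/-- The join of two flats is the closure of their union. -/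
@[reducible] def flatsSemilatticeSup (M : Matroid α) : SemilatticeSup (Flats M) where
  toPartialOrder := inferInstance
  sup F G := ⟨M.closure (F.1 ∪ G.1), M.isFlat_closure _⟩
  le_sup_left F G := Set.subset_union_left.trans
    (M.subset_closure _ (Set.union_subset F.2.subset_ground G.2.subset_ground))
  le_sup_right F G := Set.subset_union_right.trans
    (M.subset_closure _ (Set.union_subset F.2.subset_ground G.2.subset_ground))
  sup_le F G H h h' := by
    have := M.closure_subset_closure (Set.union_subset h h')
    rwa [H.2.closure] at this

/-- The flat spanned by one element. -/
def atomFlat (M : Matroid α) (i : α) : Flats M := ⟨M.closure {i}, M.isFlat_closure _⟩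

lemma atomFlat_le_iff {i : α} (hi : i ∈ M.E) {F : Flats M} : atomFlat M i ≤ F ↔ i ∈ F.1 := by
  constructor
  · intro h
    exact h (M.mem_closure_of_mem (Set.mem_singleton i) (by simpa using hi))
  · intro h
    have := M.closure_subset_closure (Set.singleton_subset_iff.2 h)
    rwa [F.2.closure] at this

/-- The matroid rank of a flat. -/
noncomputable def flatRank (F : Flats M) : ℕ := (M.eRk F.1).toNat

lemma flatRank_bot : flatRank (⊥ : Flats M) = 0 := by
  change (M.eRk (M.closure ∅)).toNat = 0
  simp

lemma flatRank_top : flatRank (⊤ : Flats M) = M.eRank.toNat := by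
  change (M.eRk M.E).toNat = _
  rw [M.eRk_ground]

lemma flatRank_atomFlat_le (i : α) : flatRank (atomFlat M i) ≤ 1 := by
  rw [flatRank, atomFlat, M.eRk_closure_eq]
  exact ENat.toNat_le_of_le_natCast (M.eRk_singleton_le i)

lemma le_closure_insert (F : Flats M) {i : α} (hi : i ∈ M.E) :
    insert i F.1 ⊆ M.closure (insert i F.1) :=
  M.subset_closure _ (Set.insert_subset hi F.2.subset_ground)

lemma closure_insert_le {F G : Flats M} (h : F ≤ G) {i : α} (hi : i ∈ G.1) :
    M.closure (insert i F.1) ⊆ G.1 := by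
  have := M.closure_subset_closure (Set.insert_subset hi h)
  rwa [G.2.closure] at this

variable [M.Finite]

lemma natCast_flatRank (F : Flats M) : (flatRank F : ℕ∞) = M.eRk F.1 :=
  ENat.natCast_toNat (by
    rw [Matroid.eRk_ne_top_iff]
    exact M.isRkFinite_set _)

lemma flatRank_closure_insert (F : Flats M) {i : α} (hi : i ∈ M.E) (hiF : i ∉ F.1) :
    flatRank (⟨M.closure (insert i F.1), M.isFlat_closure _⟩ : Flats M) = flatRank F + 1 := by
  rw [← ENat.natCast_inj, Nat.cast_add, natCast_flatRank, natCast_flatRank, M.eRk_closure_eq,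
    M.eRk_insert_eq_add_one ⟨hi, by rwa [F.2.closure]⟩]
  rfl

lemma flatRank_mono : Monotone (flatRank : Flats M → ℕ) := by
  intro F G h
  rw [← ENat.natCast_le_natCast, natCast_flatRank, natCast_flatRank]
  exact M.eRk_mono h

lemma flatRank_strictMono : StrictMono (flatRank : Flats M → ℕ) := by
  intro F G h
  obtain ⟨i, hiG, hiF⟩ := Set.exists_of_ssubset (show F.1 ⊂ G.1 from h)
  have h1 := flatRank_closure_insert F (G.2.subset_ground hiG) hiF
  have h2 : (⟨M.closure (insert i F.1), M.isFlat_closure _⟩ : Flats M) ≤ G :=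
    closure_insert_le h.le hiG
  have := flatRank_mono h2
  omega

lemma submodularAbove_flatRank :
    letI := flatsSemilatticeSup M
    SubmodularAbove (flatRank : Flats M → ℕ) := by
  intro L F G hF hG
  rw [← ENat.natCast_le_natCast, Nat.cast_add, Nat.cast_add, natCast_flatRank, natCast_flatRank,
    natCast_flatRank, natCast_flatRank, add_comm]
  refine le_trans ?_ (M.eRk_inter_add_eRk_union_le F.1 G.1)
  refine add_le_add (M.eRk_mono (Set.subset_inter hF hG)) (le_of_eq ?_)
  exact M.eRk_closure_eq _

lemma covBy_closure_insert (F : Flats M) {i : α} (hi : i ∈ M.E) (hiF : i ∉ F.1) :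
    F ⋖ ⟨M.closure (insert i F.1), M.isFlat_closure _⟩ := by
  have h := le_closure_insert F hi
  refine ⟨lt_of_le_of_ne ((Set.subset_insert _ _).trans h) fun heq => ?_, fun H h1 h2 => ?_⟩
  · have : i ∈ M.closure (insert i F.1) := h (Set.mem_insert _ _)
    exact hiF (by rwa [congr_arg Subtype.val heq])
  · have h3 := flatRank_strictMono h1
    have h4 := flatRank_strictMono h2
    rw [flatRank_closure_insert F hi hiF] at h4
    omega

lemma eq_closure_insert_of_covBy {F G : Flats M} (h : F ⋖ G) {i : α} (hiG : i ∈ G.1)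
    (hiF : i ∉ F.1) : G = ⟨M.closure (insert i F.1), M.isFlat_closure _⟩ :=
  ((h.eq_or_eq (covBy_closure_insert F (G.2.subset_ground hiG) hiF).le
    (closure_insert_le h.le hiG)).resolve_left
      (covBy_closure_insert F (G.2.subset_ground hiG) hiF).lt.ne').symm

lemma flatRank_eq_of_covBy (F G : Flats M) (h : F ⋖ G) : flatRank G = flatRank F + 1 := by
  obtain ⟨i, hiG, hiF⟩ := Set.exists_of_ssubset (show F.1 ⊂ G.1 from h.lt)
  rw [eq_closure_insert_of_covBy h hiG hiF, flatRank_closure_insert F (G.2.subset_ground hiG) hiF]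

lemma rank_flats : (rank : Flats M → ℕ) = flatRank :=
  rank_eq_of_covBy_succ flatRank_bot flatRank_eq_of_covBy

lemma isGradedPoset_flats : IsGradedPoset (Flats M) :=
  isGradedPoset_of_covBy_succ flatRank_bot flatRank_eq_of_covBy

/-! ### The R-labeling of the lattice of flats -/

/-- The edge labeling of the lattice of flats by the smallest new element. -/
noncomputable def minLabel (e : α → ℕ) (F G : Flats M) : ℕ := sInf (e '' (G.1 \ F.1))

omit [M.Finite] in
lemma minLabel_le (e : α → ℕ) {F G : Flats M} {i : α} (hiG : i ∈ G.1) (hiF : i ∉ F.1) :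
    minLabel e F G ≤ e i :=
  Nat.sInf_le ⟨i, ⟨hiG, hiF⟩, rfl⟩

omit [M.Finite] in
lemma exists_eq_minLabel (e : α → ℕ) {F G : Flats M} (h : F < G) :
    ∃ i, i ∈ G.1 ∧ i ∉ F.1 ∧ e i = minLabel e F G := by
  obtain ⟨i, hiG, hiF⟩ := Set.exists_of_ssubset (show F.1 ⊂ G.1 from h)
  obtain ⟨j, hj, hje⟩ := Nat.sInf_mem (s := e '' (G.1 \ F.1)) ⟨e i, i, ⟨hiG, hiF⟩, rfl⟩
  exact ⟨j, hj.1, hj.2, hje⟩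

omit [M.Finite] in
-- The element i enters at some step of the chain; the label of that step is at most e i and, by
-- monotonicity, at least x.
lemma le_of_isChain_labels {e : α → ℕ} {F G : Flats M} {l : List (Flats M)}
    (hl : IsMaximalChain F G l) {x : ℕ} (hx : (x :: labels (minLabel e) l).IsChain (· ≤ ·))
    {i : α} (hiG : i ∈ G.1) (hiF : i ∉ F.1) : x ≤ e i := by
  induction l generalizing F x with
  | nil => simp [IsMaximalChain] at hl
  | cons H l ih =>
    rcases hl.eq_singleton_or_exists_cons with ⟨_, rfl⟩ | ⟨F', l', h, hc, h'⟩
    · exact absurd hiG hiF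
    · obtain ⟨rfl, rfl⟩ := List.cons.inj h
      rw [labels_cons_cons, List.isChain_cons_cons] at hx
      refine hx.1.trans ?_
      by_cases hi : i ∈ F'.1
      · exact minLabel_le e hi hiF
      · exact ih h' hx.2 hi

/-- Let i be the smallest element of G \ F. If the first step of an increasing chain missed i, its
label would be at most e i by `le_of_isChain_labels`, hence equal to e i, and injectivity would put
i into that step. So the first step is the closure of F ∪ {i}, and induction finishes. -/
lemma isRLabeling_minLabel {e : α → ℕ} (he : Set.InjOn e M.E) :
    IsRLabeling (minLabel e : Flats M → Flats M → ℕ) := by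
  intro F G hFG
  induction F using WellFoundedGT.induction with
  | ind F ih =>
    rcases hFG.eq_or_lt with rfl | hlt
    · refine ⟨[F], ⟨isMaximalChain_singleton F, by simp [labels]⟩, ?_⟩
      rintro l ⟨hl, -⟩
      rcases hl.eq_singleton_or_exists_cons with ⟨h, -⟩ | ⟨F', l', -, hc, h'⟩
      · exact h
      · exact absurd h'.le hc.lt.not_ge
    obtain ⟨i, hiG, hiF, hi⟩ := exists_eq_minLabel e hlt
    have hiE := G.2.subset_ground hiG
    have hcov := covBy_closure_insert F hiE hiF
    have hle : (⟨M.closure (insert i F.1), M.isFlat_closure _⟩ : Flats M) ≤ G :=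
      closure_insert_le hFG hiG
    set F₁ : Flats M := ⟨M.closure (insert i F.1), M.isFlat_closure _⟩ with hF₁
    have hiF₁ : i ∈ F₁.1 := le_closure_insert F hiE (Set.mem_insert _ _)
    have hlow : ∀ H K : Flats M, F ≤ H → H < K → K ≤ G → e i ≤ minLabel e H K := by
      intro H K h1 h2 h3
      obtain ⟨j, hjK, hjH, hj⟩ := exists_eq_minLabel e h2
      rw [← hj, hi]
      exact minLabel_le e (h3 hjK) fun h4 => hjH (h1 h4)
    have hlab : minLabel e F F₁ = e i :=
      le_antisymm (minLabel_le e hiF₁ hiF) (hlow F F₁ le_rfl hcov.lt hle)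
    obtain ⟨L, ⟨hL, hL'⟩, huniq⟩ := ih F₁ hcov.lt hle
    refine ⟨F :: L, ⟨hL.cons hcov, ?_⟩, ?_⟩
    · rcases hL.eq_singleton_or_exists_cons with ⟨rfl, -⟩ | ⟨F₂, L', rfl, hc, h'⟩
      · simp [labels]
      · rw [labels_cons_cons, labels_cons_cons] at *
        refine List.IsChain.cons_cons ?_ hL'
        rw [hlab]
        exact hlow _ _ hcov.le hc.lt h'.le
    · rintro l ⟨hl, hl'⟩
      rcases hl.eq_singleton_or_exists_cons with ⟨-, h⟩ | ⟨F', l', rfl, hc, h'⟩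
      · exact absurd h hlt.ne
      rw [labels_cons_cons] at hl'
      have hiF' : i ∈ F'.1 := by
        by_contra hiF'
        have h1 := le_of_isChain_labels h' hl' hiG hiF'
        have h2 := hlow F F' le_rfl hc.lt h'.le
        obtain ⟨j, hjF', -, hj⟩ := exists_eq_minLabel e hc.lt
        have : j = i := he (F'.2.subset_ground hjF') hiE (hj.trans (le_antisymm h1 h2))
        exact hiF' (this ▸ hjF')
      have hF' : F' = F₁ := eq_closure_insert_of_covBy hc hiF' hiF
      rw [hF'] at h' hl' ⊢
      rw [huniq (F₁ :: l') ⟨h', hl'.tail⟩]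

lemma exists_isRLabeling_flats (M : Matroid α) [M.Finite] :
    ∃ lab : Flats M → Flats M → ℕ, IsRLabeling lab := by
  obtain ⟨e, he⟩ := Set.countable_iff_exists_injOn.1 M.ground_finite.countable
  exact ⟨minLabel e, isRLabeling_minLabel he⟩

end FlatsLattice

/-! ### Chow polynomials as Hilbert series of the Chow rings. -/

section ChowRing

/-- The Hilbert series of the ring of relations above `Z` is the Chow polynomial of `[Z, ⊤]`. -/
lemma hilbertSeries_eq_upperChowPoly {P : Type*} [SemilatticeSup P] [BoundedOrder P] [Fintype P]
    {rk : P → ℕ} (hmono : StrictMono rk) (hsub : SubmodularAbove rk)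
    (hrk : ∀ a b : P, rk b - rk a = rank b - rank a) (Z : P) :
    hilbertSeries (chainIdeal rk (Set.Ioi Z) (rk Z)) = (upperChowPoly Z : PowerSeries ℤ) := by
  classical
  induction Z using WellFoundedGT.induction with
  | ind Z ih =>
    have hcoe : Set.Ioi Z = (({W : P | Z < W} : Finset P) : Set P) := by
      ext W
      simp
    have h := hilbertSeries_chainIdeal hsub (rk Z) ({W : P | Z < W} : Finset P)
      (by rw [← hcoe]; exact isUpperSet_Ioi Z)
      (fun F hF => hmono (Finset.mem_filter.1 hF).2)
      (fun F hF G hG => hsub Z F G (Finset.mem_filter.1 hF).2.le (Finset.mem_filter.1 hG).2.le)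
    rw [← hcoe] at h
    rw [h, upperChowPoly_eq_one_add_sum, Polynomial.coe_add, Polynomial.coe_one,
      ← Polynomial.coeToPowerSeries.ringHom_apply (φ := Finset.sum _ _), map_sum]
    congr 1
    refine Finset.sum_congr rfl fun W hW => ?_
    -- Only rank differences enter, so a shifted rank function gives the same recursion.
    rw [ih W (Finset.mem_filter.1 hW).2, hrk, map_mul]
    rfl

variable {α : Type*} {M : Matroid α}

attribute [local instance] flatsSemilatticeSup

open scoped Classical in
/-- The map that sends the variable of the empty flat to zero. -/
noncomputable def toChowVars (M : Matroid α) : MvPolynomial (Flats M) ℚ →ₐ[ℚ]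
    MvPolynomial {F : Flats M // F.1.Nonempty} ℚ :=
  MvPolynomial.aeval fun F => if h : F.1.Nonempty then MvPolynomial.X ⟨F, h⟩ else 0

lemma toChowVars_X {F : Flats M} (h : F.1.Nonempty) :
    toChowVars M (MvPolynomial.X F) = MvPolynomial.X ⟨F, h⟩ := by
  simp [toChowVars, h]

lemma toChowVars_X_of_empty {F : Flats M} (h : ¬ F.1.Nonempty) :
    toChowVars M (MvPolynomial.X F) = 0 := by
  simp [toChowVars, h]

variable [M.Finite]

open scoped Classical in
lemma sum_nonempty_flats {A : Type*} [AddCommMonoid A] (φ : Flats M → A) {i : α} (hi : i ∈ M.E) :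
    ∑ F : {F : Flats M // F.1.Nonempty} with i ∈ F.1.1, φ F.1 =
      ∑ F : Flats M with atomFlat M i ≤ F, φ F := by
  refine Finset.sum_bij (fun F _ => F.1) ?_ (fun _ _ _ _ h => Subtype.ext h) ?_ fun _ _ => rfl
  · intro F hF
    simpa [atomFlat_le_iff hi] using hF
  · intro F hF
    have hF' : i ∈ F.1 := (atomFlat_le_iff hi).1 (Finset.mem_filter.1 hF).2
    exact ⟨⟨F, i, hF'⟩, by simpa using hF', rfl⟩

open scoped Classical in
lemma sum_proper_flats {A : Type*} [AddCommMonoid A] (φ : Flats M → A) {i : α} (hi : i ∈ M.E) :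
    ∑ F : {F : Flats M // F ≠ ⊤} with i ∉ F.1.1, φ F.1 =
      ∑ F : Flats M with ⊥ ≤ F ∧ ¬ atomFlat M i ≤ F, φ F := by
  refine Finset.sum_bij (fun F _ => F.1) ?_ (fun _ _ _ _ h => Subtype.ext h) ?_ fun _ _ => rfl
  · intro F hF
    simpa [atomFlat_le_iff hi] using hF
  · intro F hF
    have hF' : i ∉ F.1 := fun h => (Finset.mem_filter.1 hF).2.2 ((atomFlat_le_iff hi).2 h)
    refine ⟨⟨F, ?_⟩, by simpa using hF', rfl⟩
    rintro rfl
    exact hF' hi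

/-! ### The Chow ring -/

section Loopless

variable [M.Loopless]

omit [M.Finite] in
lemma coe_bot_flats : (⊥ : Flats M).1 = ∅ := by
  change M.closure ∅ = ∅
  exact M.loops_eq_empty

omit [M.Finite] in
lemma bot_lt_flats_iff {F : Flats M} : ⊥ < F ↔ F.1.Nonempty := by
  rw [bot_lt_iff_ne_bot, Set.nonempty_iff_ne_empty, ← coe_bot_flats (M := M), Ne, Ne,
    Subtype.ext_iff]

omit [M.Finite] in
lemma bot_lt_atomFlat {i : α} (hi : i ∈ M.E) : ⊥ < atomFlat M i :=
  bot_lt_flats_iff.2 ⟨i, (atomFlat_le_iff hi).1 le_rfl⟩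

omit [M.Loopless] in
lemma upperSum_atomFlat_toChowVars {i : α} (hi : i ∈ M.E) :
    toChowVars M (upperSum MvPolynomial.X (atomFlat M i)) ∈ chowIdeal M := by
  classical
  rw [upperSum, ← sum_nonempty_flats MvPolynomial.X hi, map_sum]
  refine Ideal.subset_span (Or.inr ⟨i, hi, Finset.sum_congr rfl fun F _ => ?_⟩)
  exact toChowVars_X F.2

/-- The linear relations say that h vanishes at every atom. An atom of some i ∈ G \ F serves as Y in
`chainRelations_of_linear`, and an atom below G gives h_G^m = 0. -/
lemma chainIdeal_le_comap_toChowVars :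
    chainIdeal flatRank (Set.Ioi (⊥ : Flats M)) (flatRank (⊥ : Flats M)) ≤
      (chowIdeal M).comap (toChowVars M) := by
  set y : Flats M → MvPolynomial {F : Flats M // F.1.Nonempty} ℚ ⧸ chowIdeal M := fun F =>
    (Ideal.Quotient.mk (chowIdeal M)).comp (toChowVars M).toRingHom (MvPolynomial.X F)
  have hy : ∀ G, upperSum y G =
      Ideal.Quotient.mk (chowIdeal M) (toChowVars M (upperSum MvPolynomial.X G)) := fun G =>
    (map_upperSum ((Ideal.Quotient.mk (chowIdeal M)).comp (toChowVars M).toRingHom) _ G).symm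
  have hatom : ∀ i ∈ M.E, upperSum y (atomFlat M i) = 0 := fun i hi => by
    rw [hy, Ideal.Quotient.eq_zero_iff_mem]
    exact upperSum_atomFlat_toChowVars hi
  have hinc : ∀ F G : Flats M, ¬ F ≤ G → ¬ G ≤ F →
      toChowVars M (MvPolynomial.X F * MvPolynomial.X G) ∈ chowIdeal M := by
    intro F G h h'
    rw [map_mul]
    by_cases hF : F.1.Nonempty
    · by_cases hG : G.1.Nonempty
      · rw [toChowVars_X hF, toChowVars_X hG]
        exact Ideal.subset_span (Or.inl ⟨⟨F, hF⟩, ⟨G, hG⟩, h, h', rfl⟩)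
      · rw [toChowVars_X_of_empty hG, mul_zero]
        exact zero_mem _
    · rw [toChowVars_X_of_empty hF, zero_mul]
      exact zero_mem _
  have hrel : ChainRelations flatRank y := by
    refine chainRelations_of_linear flatRank_strictMono submodularAbove_flatRank ?_ ?_
    · intro F G h h'
      have := Ideal.Quotient.eq_zero_iff_mem.2 (hinc F G h h')
      rwa [map_mul, map_mul] at this
    · intro F G h
      obtain ⟨i, hiG, hiF⟩ := Set.exists_of_ssubset (show F.1 ⊂ G.1 from h)
      have hi := G.2.subset_ground hiG
      exact ⟨atomFlat M i, (atomFlat_le_iff hi).2 hiG, fun h => hiF ((atomFlat_le_iff hi).1 h),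
        by rw [hatom i hi, mul_zero]⟩
  rw [chainIdeal_le_iff]
  refine ⟨fun F hF => ?_, hinc, fun F G m h h' => ?_, fun G m h h' => ?_⟩
  · rw [Ideal.mem_comap, toChowVars_X_of_empty fun h => hF (bot_lt_flats_iff.2 h)]
    exact zero_mem _
  · have := hrel.lt F G m h h'
    rw [hy] at this
    rw [Ideal.mem_comap, map_mul, map_pow, ← Ideal.Quotient.eq_zero_iff_mem, map_mul, map_pow]
    exact this
  · obtain ⟨i, hiG⟩ := bot_lt_flats_iff.1 (show ⊥ < G from h)
    have hi := G.2.subset_ground hiG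
    have h1 := flatRank_strictMono (bot_lt_atomFlat hi)
    rw [flatRank_bot] at h1 h'
    have := hrel.upperSum_pow_eq_zero submodularAbove_flatRank (hatom i hi)
      ((atomFlat_le_iff hi).2 hiG) (m := m) (by omega)
    rw [hy] at this
    rw [Ideal.mem_comap, map_pow, ← Ideal.Quotient.eq_zero_iff_mem, map_pow]
    exact this

lemma chowIdeal_le_comap_rename :
    chowIdeal M ≤ (chainIdeal flatRank (Set.Ioi (⊥ : Flats M)) (flatRank (⊥ : Flats M))).comap
      (MvPolynomial.rename (R := ℚ) (Subtype.val : {F : Flats M // F.1.Nonempty} → Flats M)) := by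
  classical
  rw [chowIdeal, Ideal.span_le]
  rintro _ (⟨F, G, h, h', rfl⟩ | ⟨i, hi, rfl⟩)
  · rw [SetLike.mem_coe, Ideal.mem_comap, map_mul, MvPolynomial.rename_X, MvPolynomial.rename_X]
    exact X_mul_X_mem_chainIdeal _ _ _ h h'
  · rw [SetLike.mem_coe, Ideal.mem_comap, map_sum]
    simp only [MvPolynomial.rename_X]
    rw [sum_nonempty_flats MvPolynomial.X hi]
    have h1 := flatRank_atomFlat_le (M := M) i
    have := upperSum_pow_mem_chainIdeal (rk := flatRank) (c := flatRank (⊥ : Flats M)) (m := 1)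
      (show atomFlat M i ∈ Set.Ioi ⊥ from bot_lt_atomFlat hi) (by omega)
    rwa [pow_one, upperSum] at this

theorem hilbertSeries_chowIdeal :
    hilbertSeries (chowIdeal M) = (chowPoly (Flats M) : PowerSeries ℤ) := by
  rw [chowPoly_eq_upperChowPoly, ← hilbertSeries_eq_upperChowPoly (rk := flatRank)
    flatRank_strictMono submodularAbove_flatRank (by simp [rank_flats])]
  refine (hilbertSeries_eq_of_graded_maps (toChowVars M) ?_ chainIdeal_le_comap_toChowVars
    (MvPolynomial.rename Subtype.val) ?_ chowIdeal_le_comap_rename ?_ ?_).symm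
  · intro F
    by_cases hF : F.1.Nonempty
    · rw [toChowVars_X hF]
      exact MvPolynomial.isHomogeneous_X _ _
    · rw [toChowVars_X_of_empty hF]
      exact MvPolynomial.isHomogeneous_zero _ _ _
  · intro F
    rw [MvPolynomial.rename_X]
    exact MvPolynomial.isHomogeneous_X _ _
  · intro F
    by_cases hF : F.1.Nonempty
    · rw [toChowVars_X hF, MvPolynomial.rename_X, sub_self]
      exact zero_mem _
    · rw [toChowVars_X_of_empty hF, map_zero, zero_sub]
      exact neg_mem (X_mem_chainIdeal _ _ fun h => hF (bot_lt_flats_iff.1 h))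
  · intro F
    rw [MvPolynomial.rename_X, toChowVars_X F.2, sub_self]
    exact zero_mem _

end Loopless

/-! ### The augmented Chow ring -/

open scoped Classical in
/-- The map that sends the variable of the ground set to minus the sum of all variables of proper
flats. -/
noncomputable def toAugChowVars (M : Matroid α) [M.Finite] : MvPolynomial (Flats M) ℚ →ₐ[ℚ]
    MvPolynomial ({F : Flats M // F ≠ ⊤} ⊕ M.E) ℚ :=
  MvPolynomial.aeval fun F => if h : F ≠ ⊤ then MvPolynomial.X (Sum.inl ⟨F, h⟩) else
    -∑ G : {F : Flats M // F ≠ ⊤}, MvPolynomial.X (Sum.inl G)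

/-- The map that sends the variable of an element `i` to minus the sum of the variables of the
flats containing `i`. -/
noncomputable def ofAugChowVars (M : Matroid α) [M.Finite] :
    MvPolynomial ({F : Flats M // F ≠ ⊤} ⊕ M.E) ℚ →ₐ[ℚ] MvPolynomial (Flats M) ℚ :=
  MvPolynomial.aeval (Sum.elim (fun F => MvPolynomial.X F.1)
    fun i => -upperSum MvPolynomial.X (atomFlat M i.1))

lemma toAugChowVars_X {F : Flats M} (h : F ≠ ⊤) :
    toAugChowVars M (MvPolynomial.X F) = MvPolynomial.X (Sum.inl ⟨F, h⟩) := by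
  simp [toAugChowVars, h]

open scoped Classical in
lemma toAugChowVars_X_top : toAugChowVars M (MvPolynomial.X ⊤) =
    -∑ G : {F : Flats M // F ≠ ⊤}, MvPolynomial.X (Sum.inl G) := by
  simp [toAugChowVars]

lemma ofAugChowVars_inl (F : {F : Flats M // F ≠ ⊤}) :
    ofAugChowVars M (MvPolynomial.X (Sum.inl F)) = MvPolynomial.X F.1 := by
  simp [ofAugChowVars]

lemma ofAugChowVars_inr (i : M.E) : ofAugChowVars M (MvPolynomial.X (Sum.inr i)) =
    -upperSum MvPolynomial.X (atomFlat M i.1) := by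
  simp [ofAugChowVars]

lemma upperSum_bot_eq : (upperSum MvPolynomial.X (⊥ : Flats M) : MvPolynomial (Flats M) ℚ) =
    (∑ F : {F : Flats M // F ≠ ⊤}, MvPolynomial.X F.1) + MvPolynomial.X ⊤ := by
  classical
  rw [upperSum, Finset.filter_true_of_mem fun _ _ => bot_le,
    ← Finset.sum_erase_add _ _ (Finset.mem_univ (⊤ : Flats M))]
  congr 1
  rw [Finset.sum_subtype (Finset.univ.erase (⊤ : Flats M)) (p := fun F => F ≠ ⊤) (by simp)]

lemma toAugChowVars_upperSum_bot :
    toAugChowVars M (upperSum MvPolynomial.X (⊥ : Flats M)) = 0 := by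
  classical
  rw [upperSum_bot_eq, map_add, map_sum, toAugChowVars_X_top]
  rw [Finset.sum_congr rfl fun F _ => toAugChowVars_X F.2]
  exact add_neg_cancel _

/-- The choice of the image of x_⊤ makes h_⊥ = 0, so y_i = ∑_{F ∌ i} x_F = h_⊥ − h_{atom} =
−h_{atom}. -/
lemma X_add_toAugChowVars_upperSum_mem (i : M.E) :
    MvPolynomial.X (Sum.inr i) + toAugChowVars M (upperSum MvPolynomial.X (atomFlat M i.1)) ∈
      augChowIdeal M := by
  classical
  have h := congr_arg (toAugChowVars M)
    (upperSum_sub_upperSum (MvPolynomial.X (R := ℚ)) (bot_le : ⊥ ≤ atomFlat M i.1))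
  rw [map_sub, toAugChowVars_upperSum_bot, zero_sub, ← sum_proper_flats MvPolynomial.X i.2, map_sum,
    Finset.sum_congr rfl fun F _ => toAugChowVars_X F.2] at h
  refine Ideal.subset_span (Or.inr ⟨i, ?_⟩)
  rw [← h, sub_neg_eq_add]

/-- The rank function of the lattice of flats, shifted by one. -/
noncomputable def succFlatRank (F : Flats M) : ℕ := flatRank F + 1

lemma submodularAbove_succFlatRank : SubmodularAbove (succFlatRank : Flats M → ℕ) := by
  intro L F G hF hG
  have := submodularAbove_flatRank L F G hF hG
  simp only [succFlatRank]
  omega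

lemma succFlatRank_strictMono : StrictMono (succFlatRank : Flats M → ℕ) :=
  fun _ _ h => Nat.succ_lt_succ (flatRank_strictMono h)

/-- The shifted rank is the one seen from an extra minimum below ⊥, so that ⊥ has rank 1 and h_⊥ = 0
is itself a relation. The linear relations come from y_i x_F = 0 with y_i = −h_{atom}. -/
lemma chainIdeal_le_comap_toAugChowVars :
    chainIdeal succFlatRank (Set.univ : Set (Flats M)) 0 ≤
      (augChowIdeal M).comap (toAugChowVars M) := by
  set y : Flats M → MvPolynomial ({F : Flats M // F ≠ ⊤} ⊕ M.E) ℚ ⧸ augChowIdeal M := fun F =>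
    (Ideal.Quotient.mk (augChowIdeal M)).comp (toAugChowVars M).toRingHom (MvPolynomial.X F)
  have hy : ∀ G, upperSum y G =
      Ideal.Quotient.mk (augChowIdeal M) (toAugChowVars M (upperSum MvPolynomial.X G)) := fun G =>
    (map_upperSum ((Ideal.Quotient.mk (augChowIdeal M)).comp (toAugChowVars M).toRingHom) _ G).symm
  have hinc : ∀ F G : Flats M, ¬ F ≤ G → ¬ G ≤ F →
      toAugChowVars M (MvPolynomial.X F * MvPolynomial.X G) ∈ augChowIdeal M := by
    intro F G h h'
    have hF : F ≠ ⊤ := by rintro rfl; exact h' le_top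
    have hG : G ≠ ⊤ := by rintro rfl; exact h le_top
    rw [map_mul, toAugChowVars_X hF, toAugChowVars_X hG]
    exact Ideal.subset_span (Or.inl (Or.inl ⟨⟨F, hF⟩, ⟨G, hG⟩, h, h', rfl⟩))
  have hrel : ChainRelations succFlatRank y := by
    refine chainRelations_of_linear succFlatRank_strictMono submodularAbove_succFlatRank ?_ ?_
    · intro F G h h'
      have := Ideal.Quotient.eq_zero_iff_mem.2 (hinc F G h h')
      rwa [map_mul, map_mul] at this
    · intro F G h
      obtain ⟨i, hiG, hiF⟩ := Set.exists_of_ssubset (show F.1 ⊂ G.1 from h)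
      have hi := G.2.subset_ground hiG
      refine ⟨atomFlat M i, (atomFlat_le_iff hi).2 hiG, fun h => hiF ((atomFlat_le_iff hi).1 h), ?_⟩
      have hF : F ≠ ⊤ := h.ne_top
      have h1 : (MvPolynomial.X (Sum.inr ⟨i, hi⟩) * MvPolynomial.X (Sum.inl ⟨F, hF⟩) :
          MvPolynomial ({F : Flats M // F ≠ ⊤} ⊕ M.E) ℚ) ∈ augChowIdeal M :=
        Ideal.subset_span (Or.inl (Or.inr ⟨⟨i, hi⟩, ⟨F, hF⟩, hiF, rfl⟩))
      have h2 := Ideal.mul_mem_right (MvPolynomial.X (Sum.inl ⟨F, hF⟩)) _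
        (X_add_toAugChowVars_upperSum_mem ⟨i, hi⟩)
      have h3 := sub_mem h2 h1
      rw [add_mul, add_sub_cancel_left, ← toAugChowVars_X hF, mul_comm] at h3
      rw [hy]
      have := Ideal.Quotient.eq_zero_iff_mem.2 h3
      rwa [map_mul] at this
  rw [chainIdeal_le_iff]
  refine ⟨fun F hF => absurd (Set.mem_univ F) hF, hinc, fun F G m h h' => ?_, fun G m h h' => ?_⟩
  · have := hrel.lt F G m h h'
    rw [hy] at this
    rw [Ideal.mem_comap, map_mul, map_pow, ← Ideal.Quotient.eq_zero_iff_mem, map_mul, map_pow]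
    exact this
  · have hbot : upperSum y ⊥ = 0 := by
      rw [hy, toAugChowVars_upperSum_bot, map_zero]
    have := hrel.upperSum_pow_eq_zero submodularAbove_succFlatRank hbot bot_le (G := G) (m := m)
      (by rw [succFlatRank, succFlatRank, flatRank_bot] at *; omega)
    rw [hy] at this
    rw [Ideal.mem_comap, map_pow, ← Ideal.Quotient.eq_zero_iff_mem, map_pow]
    exact this

lemma upperSum_bot_mem_chainIdeal : upperSum MvPolynomial.X (⊥ : Flats M) ∈
    chainIdeal succFlatRank (Set.univ : Set (Flats M)) 0 := by
  have := upperSum_pow_mem_chainIdeal (rk := succFlatRank) (c := 0) (m := 1)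
    (Set.mem_univ (⊥ : Flats M)) (by rw [succFlatRank, flatRank_bot])
  rwa [pow_one] at this

lemma augChowIdeal_le_comap_ofAugChowVars :
    augChowIdeal M ≤ (chainIdeal succFlatRank (Set.univ : Set (Flats M)) 0).comap
      (ofAugChowVars M) := by
  classical
  rw [augChowIdeal, Ideal.span_le]
  rintro _ ((⟨F, G, h, h', rfl⟩ | ⟨i, F, hi, rfl⟩) | ⟨i, rfl⟩)
  · rw [SetLike.mem_coe, Ideal.mem_comap, map_mul, ofAugChowVars_inl, ofAugChowVars_inl]
    exact X_mul_X_mem_chainIdeal _ _ _ h h'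
  · rw [SetLike.mem_coe, Ideal.mem_comap, map_mul, ofAugChowVars_inl, ofAugChowVars_inr, neg_mul,
      mul_comm]
    refine neg_mem ?_
    -- Joining an atom raises the rank by at most one, so x_F h_{atom} = 0 holds with exponent 1.
    have h1 := submodularAbove_flatRank ⊥ F.1 (atomFlat M i.1) bot_le bot_le
    have h2 := flatRank_atomFlat_le (M := M) i.1
    have := (chainRelations_quotient succFlatRank (Set.univ : Set (Flats M)) 0).mul_upperSum_pow
      (F := F.1) (G := atomFlat M i.1) (fun h => hi ((atomFlat_le_iff i.2).1 h)) (m := 1)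
      (by simp only [succFlatRank]; omega)
    rwa [← map_upperSum, pow_one, ← map_mul, Ideal.Quotient.eq_zero_iff_mem] at this
  · rw [SetLike.mem_coe, Ideal.mem_comap, map_sub, map_sum, ofAugChowVars_inr]
    simp only [ofAugChowVars_inl]
    rw [sum_proper_flats MvPolynomial.X i.2, ← upperSum_sub_upperSum _ bot_le]
    convert neg_mem (upperSum_bot_mem_chainIdeal (M := M)) using 1
    ring

lemma hilbertSeries_augChowIdeal_eq :
    hilbertSeries (augChowIdeal M) =
      hilbertSeries (chainIdeal succFlatRank (Set.univ : Set (Flats M)) 0) := by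
  classical
  have : Finite M.E := M.ground_finite.to_subtype
  refine (hilbertSeries_eq_of_graded_maps (toAugChowVars M) ?_ chainIdeal_le_comap_toAugChowVars
    (ofAugChowVars M) ?_ augChowIdeal_le_comap_ofAugChowVars ?_ ?_).symm
  · intro F
    by_cases hF : F = ⊤
    · subst hF
      rw [toAugChowVars_X_top]
      exact (MvPolynomial.IsHomogeneous.sum _ _ _ fun _ _ => MvPolynomial.isHomogeneous_X _ _).neg
    · rw [toAugChowVars_X hF]
      exact MvPolynomial.isHomogeneous_X _ _
  · rintro (F | i)
    · rw [ofAugChowVars_inl]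
      exact MvPolynomial.isHomogeneous_X _ _
    · rw [ofAugChowVars_inr]
      exact (IsExtension.isHomogeneous_upperSum _).neg
  · intro F
    by_cases hF : F = ⊤
    · subst hF
      rw [toAugChowVars_X_top, map_neg, map_sum]
      simp only [ofAugChowVars_inl]
      rw [← neg_add', ← upperSum_bot_eq]
      exact neg_mem upperSum_bot_mem_chainIdeal
    · rw [toAugChowVars_X hF, ofAugChowVars_inl, sub_self]
      exact zero_mem _
  · rintro (F | i)
    · rw [ofAugChowVars_inl, toAugChowVars_X F.2, sub_self]
      exact zero_mem _
    · rw [ofAugChowVars_inr, map_neg, ← neg_add', add_comm]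
      exact neg_mem (X_add_toAugChowVars_upperSum_mem i)

/-- The shift cancels the −1 in the length of the geometric sum, which gives the factor `truncGeom
(rank Z)` of the augmented recursion. -/
theorem hilbertSeries_augChowIdeal :
    hilbertSeries (augChowIdeal M) = (augChowPoly (Flats M) : PowerSeries ℤ) := by
  classical
  have h := hilbertSeries_chainIdeal (submodularAbove_succFlatRank (M := M)) 0 Finset.univ
    (by simpa using isUpperSet_univ) (fun F _ => Nat.succ_pos _) fun F _ G _ => by
      have := submodularAbove_succFlatRank ⊥ F G bot_le bot_le
      omega
  rw [Finset.coe_univ] at h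
  rw [hilbertSeries_augChowIdeal_eq, h, augChowPoly_eq_one_add_sum, Polynomial.coe_add,
    Polynomial.coe_one, ← Polynomial.coeToPowerSeries.ringHom_apply (φ := Finset.sum _ _), map_sum]
  congr 1
  refine Finset.sum_congr rfl fun Z _ => ?_
  rw [hilbertSeries_eq_upperChowPoly succFlatRank_strictMono submodularAbove_succFlatRank
    (by simp [rank_flats, succFlatRank]), map_mul, rank_flats]
  rfl

end ChowRing

end ChowPolynomials

theorem mainTheorem4 :
    -- loopless matroids
    (∀ (α : Type*) (M : Matroid α) [M.Finite] [M.Loopless],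
      -- as Hilbert–Poincaré series of the Chow and the augmented Chow ring
      (∃ p : ℤ[X], (p : PowerSeries ℤ) =
          ChowPolynomials.hilbertSeries (ChowPolynomials.chowIdeal M) ∧
        ChowPolynomials.IsGoodOfDegree (M.eRank.toNat - 1) p) ∧
      (∃ p : ℤ[X], (p : PowerSeries ℤ) =
          ChowPolynomials.hilbertSeries (ChowPolynomials.augChowIdeal M) ∧
        ChowPolynomials.IsGoodOfDegree M.eRank.toNat p) ∧
      -- as sums over chains in the lattice of flats
      ChowPolynomials.IsGoodOfDegree (M.eRank.toNat - 1)
        (ChowPolynomials.chowPoly (ChowPolynomials.Flats M)) ∧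
      ChowPolynomials.IsGoodOfDegree M.eRank.toNat
        (ChowPolynomials.augChowPoly (ChowPolynomials.Flats M))) ∧
    -- finite graded posets admitting an R-labeling
    (∀ (P : Type*) [PartialOrder P] [BoundedOrder P] [Fintype P],
      ChowPolynomials.IsGradedPoset P →
      (∃ lab : P → P → ℕ, ChowPolynomials.IsRLabeling lab) →
      ChowPolynomials.IsGoodOfDegree (ChowPolynomials.rank (⊤ : P) - 1)
        (ChowPolynomials.chowPoly P) ∧
      ChowPolynomials.IsGoodOfDegree (ChowPolynomials.rank (⊤ : P))
        (ChowPolynomials.augChowPoly P)) := by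
  refine ⟨fun α M _ _ => ?_, fun P _ _ _ hP ⟨lab, hlab⟩ =>
    ⟨ChowPolynomials.isGoodOfDegree_chowPoly hP hlab,
      ChowPolynomials.isGoodOfDegree_augChowPoly hP hlab⟩⟩
  obtain ⟨lab, hlab⟩ := ChowPolynomials.exists_isRLabeling_flats M
  have hP := ChowPolynomials.isGradedPoset_flats (M := M)
  have h1 := ChowPolynomials.isGoodOfDegree_chowPoly hP hlab
  have h2 := ChowPolynomials.isGoodOfDegree_augChowPoly hP hlab
  rw [ChowPolynomials.rank_flats, ChowPolynomials.flatRank_top] at h1 h2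
  exact ⟨⟨_, ChowPolynomials.hilbertSeries_chowIdeal.symm, h1⟩,
    ⟨_, ChowPolynomials.hilbertSeries_augChowIdeal.symm, h2⟩, h1, h2⟩
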